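/- Let $0<q<1$ and $\lambda\in\mathbb R$. Write $(n)_q=\frac{1-q^n}{1-q}$, $(n)_q!=(1)_q\cdots(n)_q$, $(a;q)_k=\prod_{i=0}^{k-1}(1-aq^i)$, $e_q^x=\prod_{i\ge0}\bigl(1-(1-q)q^ix\bigr)^{-1}$ (which equals $\sum_k x^k/(k)_q!$ for $|x|<1/(1-q)$), and let $$\Phi^q(a,b;x)=\sum_{k=0}^\infty\frac{q^{k(k-1)/2}(a;q)_k}{(q;q)_k(b;q)_k}\bigl((1-q)x\bigr)^k$$ be the q-Kummer function. On the span $\mathcal F$ of the orthonormal basis $|k\rangle$, $k\in\mathbb Z$, of $\ell^2(\mathbb Z)$ let $B|k\rangle=q^{k/2}|k-1\rangle$, $B^*|k\rangle=q^{(k+1)/2}|k+1\rangle$, $A|k\rangle=|k-2\rangle$, $A^*=A^{-1}$, and $\eta^2=B^*B$, so that $\eta^2|k\rangle=q^k|k\rangle$. For $m,n\in\mathbb N=\{0,1,2,\dots\}$ put $$U_{mn}=A^{-m}B^{*\,n-m}\,\Phi_{mn}(\eta)\quad(n\ge m),\qquad U_{mn}=q^{\frac{(m-n)(m-n-1)}2}A^{-m}(-B)^{m-n}\,\Phi_{nm}(\eta)\quad(m\ge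 n),$$ $$\Phi_{mn}(\eta)=\sqrt{\tfrac{(n)_q!}{(m)_q!}}\;\frac{\sqrt{e_q^{-\eta^2}}}{(n-m)_q!}\;\Phi^q(q^{-m},q^{1+n-m};q^{n+1}\eta^2)\quad (m\le n),$$ and let $U^*_{ms}=(U_{sm})^*$ be the adjoint. For $i,j\in\mathbb Z$ put $$t^\lambda_{ij}=q^{\frac{i^2-j^2}4}\frac{(i_0\lambda B)^{i-j}A^j}{(i-j)_q!}\,\Phi^q\bigl(0,q^{1+i-j};(q-1)q^{1-j}\lambda^2\eta^2\bigr)\quad(i\ge j),$$ $$t^\lambda_{ij}=q^{\frac{i^2-j^2}4}\frac{A^j(i_0\lambda B^*)^{j-i}}{(j-i)_q!}\,\Phi^q\bigl(0,q^{1+j-i};(q-1)q^{1-i}\lambda^2\eta^2\bigr)\quad(j\ge i),$$ where $i_0=\sqrt{-1}$. On the span of the orthonormal vectors $|n\rangle$, $n\in\mathbb N$, let $z|n\rangle=\sqrt{(n)_q}\,|n-1\rangle$, $z^*|n\rangle=\sqrt{(n+1)_q}\,|n+1\rangle$ and $\zeta=1-(1-q)z^*z$, so that $\zeta|n\rangle=q^n|n\rangle$;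 for $j\ge0$ let $$f^\lambda_j(\zeta)=\frac{q^{j^2/4}(i_0\lambda)^j}{(j)_q!}\,\Phi^q(\zeta^{-1},q^{j+1};q^{j+1}\lambda^2\zeta),\qquad D^\lambda_j=f^\lambda_j(\zeta)\,z^j,\qquad D^\lambda_{-j}=z^{*j}f^\lambda_j(\zeta),$$ and let $(D^\lambda_j)_{mn}=\langle m|D^\lambda_j|n\rangle$ denote the matrix elements. Then: (a) The $U_{mn}$ are the matrix elements of the operator $U:|n,k\rangle\mapsto|n,k\rangle'$. That is, let $|n,k\rangle=|n\rangle\otimes|k\rangle$, let $\delta(z^*)=B^*+A^*z^*$, and let $$|0,k\rangle'=e_q^{-A^*Bz^*}\sqrt{e_q^{-B^*B}}\;|0,k\rangle,\qquad |n,k\rangle'=\frac{\delta(z^*)^n}{\sqrt{(n)_q!}}\,|0,k\rangle',$$ where $e_q^{-A^*Bz^*}$ is expanded as $\sum_r(-A^*Bz^*)^r/(r)_q!$ and vectors are written as formal sums $\sum_m|m\rangle\otimes\psi_m$ with $\psi_m\in\mathcal F$. Then the component of $|n,k\rangle'$ along $|m\rangle$ is $U_{mn}|k\rangle$, for all $m,n\in\mathbb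 N$ and $k\in\mathbb Z$. (b) For all $j\in\mathbb Z$ and $m,n\in\mathbb N$, $$\sum_{s,l=0}^\infty (D^\lambda_{l-s})_{sl}\;U^*_{ms}\,t^\lambda_{j,\,l-s}\,U_{ln}=(D^\lambda_j)_{mn}\,\delta_{j,\,n-m}$$ (a multiple of the identity operator), where the double series, applied to any vector of $\mathcal F$, converges unconditionally in $\ell^2(\mathbb Z)$. -/

import Mathlib

open scoped BigOperators

noncomputable section

namespace QPlane

/-! ### q-numbers, q-exponential and q-Kummer function -/

/-- The q-number `(n)_q = (1 - q^n) / (1 - q)`. -/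
def qNum (q : ℝ) (n : ℕ) : ℝ := (1 - q ^ n) / (1 - q)

/-- The q-factorial `(n)_q! = (1)_q (2)_q ⋯ (n)_q`. -/
def qFact (q : ℝ) (n : ℕ) : ℝ := ∏ k ∈ Finset.range n, qNum q (k + 1)

/-- The q-shifted factorial `(a; q)_k = (1 - a)(1 - a q) ⋯ (1 - a q^(k-1))`. -/
def qPoch (a q : ℝ) (k : ℕ) : ℝ := ∏ i ∈ Finset.range k, (1 - a * q ^ i)

/-- The q-Kummer function
`Φ^q(a, b; x) = ∑_k q^(k(k-1)/2) (a;q)_k / ((q;q)_k (b;q)_k) ((1-q)x)^k`. -/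
def qKummer (q a b x : ℝ) : ℝ :=
  ∑' k : ℕ, q ^ (k.choose 2) * qPoch a q k / (qPoch q q k * qPoch b q k) * ((1 - q) * x) ^ k

/-- The q-exponential function `e_q^x = 1 / ∏_{i ≥ 0} (1 - (1 - q) q^i x)`. For
`|x| < 1 / (1 - q)` it is the sum of the series `∑_k x^k / (k)_q!` (see `hasSum_qExp`); the
product continues it to the whole negative axis, where it is needed below. -/
def qExp (q x : ℝ) : ℝ := (∏' i : ℕ, (1 - (1 - q) * q ^ i * x))⁻¹

/-! ### Operators on the span of the states `|k⟩`, `k ∈ ℤ`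

The domain is the space `ℤ →₀ ℂ` of finite linear combinations of the orthonormal vectors `|k⟩`,
and `|k⟩` is `Finsupp.single k 1`. -/

/-- `A^i |k⟩ = |k - 2 i⟩` for every integer `i`; in particular `A^* = A^(-1)`. -/
def opAPow (i : ℤ) : Module.End ℂ (ℤ →₀ ℂ) :=
  Finsupp.linearCombination ℂ fun k : ℤ => Finsupp.single (k - 2 * i) (1 : ℂ)

/-- `B |k⟩ = q^(k/2) |k - 1⟩`. -/
def opB (q : ℝ) : Module.End ℂ (ℤ →₀ ℂ) :=
  Finsupp.linearCombination ℂ fun k : ℤ =>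
    Finsupp.single (k - 1) ((q ^ ((k : ℝ) / 2) : ℝ) : ℂ)

/-- `B^* |k⟩ = q^((k+1)/2) |k + 1⟩`. -/
def opBStar (q : ℝ) : Module.End ℂ (ℤ →₀ ℂ) :=
  Finsupp.linearCombination ℂ fun k : ℤ =>
    Finsupp.single (k + 1) ((q ^ (((k : ℝ) + 1) / 2) : ℝ) : ℂ)

/-- The function `F(η²)` of the operator `η² = B^* B`. Since `η² |k⟩ = q^k |k⟩`
(see `opBStar_mul_opB`), it is the diagonal operator `|k⟩ ↦ F(q^k) |k⟩`. -/
def etaFun (q : ℝ) (F : ℝ → ℝ) : Module.End ℂ (ℤ →₀ ℂ) :=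
  Finsupp.linearCombination ℂ fun k : ℤ => Finsupp.single k ((F (q ^ k) : ℝ) : ℂ)

/-- For `m ≤ n`, the function `Φ_{mn}` written in the variable `x = η²`. -/
def PhiFun (q : ℝ) (m n : ℕ) (x : ℝ) : ℝ :=
  √(qFact q n / qFact q m) * (√(qExp q (-x)) / qFact q (n - m)) *
    qKummer q (q ^ (-(m : ℤ))) (q ^ (1 + n - m)) (q ^ (n + 1) * x)

/-- The operators `U_{mn}`:
`A^(-m) B^*^(n-m) Φ_{mn}(η)` if `m ≤ n`, and
`q^((m-n)(m-n-1)/2) A^(-m) (-B)^(m-n) Φ_{nm}(η)` if `n ≤ m`. -/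
def U (q : ℝ) (m n : ℕ) : Module.End ℂ (ℤ →₀ ℂ) :=
  if m ≤ n then
    opAPow (-(m : ℤ)) * opBStar q ^ (n - m) * etaFun q (PhiFun q m n)
  else
    ((q ^ ((m - n).choose 2) : ℝ) : ℂ) •
      (opAPow (-(m : ℤ)) * (-opB q) ^ (m - n) * etaFun q (PhiFun q n m))

/-- The operators `U^*_{ms} = (U_{sm})^*`, the adjoints being written out factor by factor;
see `inner_UStar` for the defining property. -/
def UStar (q : ℝ) (m s : ℕ) : Module.End ℂ (ℤ →₀ ℂ) :=
  if s ≤ m then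
    etaFun q (PhiFun q s m) * opB q ^ (m - s) * opAPow (s : ℤ)
  else
    ((q ^ ((s - m).choose 2) : ℝ) : ℂ) •
      (etaFun q (PhiFun q m s) * (-opBStar q) ^ (s - m) * opAPow (s : ℤ))

/-- The matrix elements `t^λ_{ij}` of the irreducible representation of `E_q(2)` of weight `λ`:
`q^((i²-j²)/4) (iλB)^(i-j) A^j / (i-j)_q! Φ^q(0, q^(1+i-j); (q-1) q^(1-j) (λη)²)` if `j ≤ i`, and
`q^((i²-j²)/4) A^j (iλB^*)^(j-i) / (j-i)_q! Φ^q(0, q^(1+j-i); (q-1) q^(1-i) (λη)²)` if `i ≤ j`. -/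
def t (q lam : ℝ) (i j : ℤ) : Module.End ℂ (ℤ →₀ ℂ) :=
  if j ≤ i then
    ((q ^ (((i : ℝ) ^ 2 - (j : ℝ) ^ 2) / 4) / qFact q (i - j).toNat : ℝ) : ℂ) •
      (((Complex.I * (lam : ℂ)) • opB q) ^ (i - j).toNat * opAPow j *
        etaFun q (fun x => qKummer q 0 (q ^ (1 + i - j)) ((q - 1) * q ^ (1 - j) * (lam ^ 2 * x))))
  else
    ((q ^ (((i : ℝ) ^ 2 - (j : ℝ) ^ 2) / 4) / qFact q (j - i).toNat : ℝ) : ℂ) •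
      (opAPow j * ((Complex.I * (lam : ℂ)) • opBStar q) ^ (j - i).toNat *
        etaFun q (fun x => qKummer q 0 (q ^ (1 + j - i)) ((q - 1) * q ^ (1 - i) * (lam ^ 2 * x))))

/-! ### The Fock space of `z`, `z^*` and the functions `D^λ_j(z, z^*)` -/

/-- `z |n⟩ = √(n)_q |n - 1⟩` (which is `0` for `n = 0`). -/
def opZ (q : ℝ) : Module.End ℂ (ℕ →₀ ℂ) :=
  Finsupp.linearCombination ℂ fun n : ℕ => Finsupp.single (n - 1) ((√(qNum q n) : ℝ) : ℂ)

/-- `z^* |n⟩ = √(n+1)_q |n + 1⟩`. -/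
def opZStar (q : ℝ) : Module.End ℂ (ℕ →₀ ℂ) :=
  Finsupp.linearCombination ℂ fun n : ℕ => Finsupp.single (n + 1) ((√(qNum q (n + 1)) : ℝ) : ℂ)

/-- The function `F(ζ)` of `ζ = 1 - (1 - q) z^* z`. Since `ζ |n⟩ = q^n |n⟩` (see `zeta_single`), it
is the diagonal operator `|n⟩ ↦ F(q^n) |n⟩`. -/
def zetaFun (q : ℝ) (F : ℝ → ℂ) : Module.End ℂ (ℕ →₀ ℂ) :=
  Finsupp.linearCombination ℂ fun n : ℕ => Finsupp.single n (F (q ^ n))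

/-- `f^λ_j(ζ) = q^(j²/4) (iλ)^j / (j)_q! Φ^q(ζ^(-1), q^(j+1); q^(j+1) λ² ζ)` for `j ≥ 0`. -/
def fFun (q lam : ℝ) (j : ℕ) (ζ : ℝ) : ℂ :=
  ((q ^ ((j : ℝ) ^ 2 / 4) : ℝ) : ℂ) * (Complex.I * (lam : ℂ)) ^ j / ((qFact q j : ℝ) : ℂ) *
    ((qKummer q ζ⁻¹ (q ^ (j + 1)) (q ^ (j + 1) * lam ^ 2 * ζ) : ℝ) : ℂ)

/-- `D^λ_j = f^λ_j(ζ) z^j` for `j ≥ 0` and `D^λ_j = z^*^(-j) f^λ_{-j}(ζ)` for `j ≤ 0`. -/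
def D (q lam : ℝ) (j : ℤ) : Module.End ℂ (ℕ →₀ ℂ) :=
  if 0 ≤ j then zetaFun q (fFun q lam j.toNat) * opZ q ^ j.toNat
  else opZStar q ^ (-j).toNat * zetaFun q (fFun q lam (-j).toNat)

/-- The matrix elements `(D^λ_j)_{mn} = ⟨m| D^λ_j |n⟩`. -/
def DMat (q lam : ℝ) (j : ℤ) (m n : ℕ) : ℂ := D q lam j (Finsupp.single n 1) m

/-! ### The transformed basis `|n, k⟩'`

A function `ψ : ℕ → (ℤ →₀ ℂ)` stands for the vector `∑_m |m⟩ ⊗ ψ_m`, so that `|n, k⟩` is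
`Pi.single n (Finsupp.single k 1)`. -/

/-- An operator on the second tensor factor. -/
def onZ (T : Module.End ℂ (ℤ →₀ ℂ)) : Module.End ℂ (ℕ → (ℤ →₀ ℂ)) := T.compLeft ℕ

/-- The operator `z^*` on the first tensor factor: the component of `z^* ψ` at `|m⟩` is
`√(m)_q ψ_{m-1}`, and it is `0` for `m = 0` because `(0)_q = 0`. -/
def onFockZStar (q : ℝ) : Module.End ℂ (ℕ → (ℤ →₀ ℂ)) where
  toFun ψ m := ((√(qNum q m) : ℝ) : ℂ) • ψ (m - 1)
  map_add' ψ φ := by funext m; simp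
  map_smul' c ψ := by
    funext m
    simp only [Pi.smul_apply, RingHom.id_apply]
    exact smul_comm _ _ _

/-- `δ(z^*) = B^* + A^* z^*`. -/
def deltaZStar (q : ℝ) : Module.End ℂ (ℕ → (ℤ →₀ ℂ)) :=
  onZ (opBStar q) + onZ (opAPow (-1)) * onFockZStar q

/-- The ground state `|0, k⟩' = e_q^(-A^* B z^*) √(e_q^(-B^* B)) |0, k⟩`, where
`e_q^X = ∑_r X^r / (r)_q!`. In each component only one term of the series is nonzero. -/
def ground (q : ℝ) (k : ℤ) : ℕ → (ℤ →₀ ℂ) := fun m =>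
  ∑ᶠ r : ℕ, (((qFact q r)⁻¹ : ℝ) : ℂ) •
    ((-(onZ (opAPow (-1) * opB q) * onFockZStar q)) ^ r)
      (Pi.single 0 (etaFun q (fun x => √(qExp q (-x))) (Finsupp.single k 1))) m

/-- The vectors `|n, k⟩' = δ(z^*)^n |0, k⟩' / √((n)_q!)`. -/
def primed (q : ℝ) (n : ℕ) (k : ℤ) : ℕ → (ℤ →₀ ℂ) :=
  (((√(qFact q n))⁻¹ : ℝ) : ℂ) • (deltaZStar q ^ n) (ground q k)

/-! ### The Hilbert space -/

/-- The inclusion of the finite linear combinations of the `|k⟩` in the Hilbert space `ℓ²(ℤ)`. -/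
def toL2 : (ℤ →₀ ℂ) →ₗ[ℂ] lp (fun _ : ℤ => ℂ) 2 :=
  Finsupp.linearCombination ℂ fun k : ℤ => lp.single 2 k (1 : ℂ)

/-! ### Checks on the definitions -/

theorem toL2_apply (ψ : ℤ →₀ ℂ) (k : ℤ) : toL2 ψ k = ψ k := by
  induction ψ using Finsupp.induction_linear with
  | zero => simp
  | add f g hf hg => simp [hf, hg]
  | single a b =>
    simp [toL2, Finsupp.linearCombination_single, Finsupp.single_apply, Pi.single_apply, eq_comm]

theorem opBStar_mul_opB {q : ℝ} (hq : 0 < q) : opBStar q * opB q = etaFun q (fun x => x) := by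
  refine Finsupp.lhom_ext' fun k => LinearMap.ext_ring ?_
  simp only [LinearMap.comp_apply, Module.End.mul_apply, opBStar, opB, etaFun,
    Finsupp.lsingle_apply, Finsupp.linearCombination_single, one_smul, Finsupp.smul_single,
    smul_eq_mul]
  rw [sub_add_cancel]
  congr 1
  rw [← Complex.ofReal_mul, ← Real.rpow_add hq, ← Real.rpow_intCast]
  congr 2
  push_cast
  ring

theorem qNum_nonneg {q : ℝ} (hq : 0 < q) (hq1 : q < 1) (n : ℕ) : 0 ≤ qNum q n :=
  div_nonneg (sub_nonneg.2 (pow_le_one₀ hq.le hq1.le)) (sub_nonneg.2 hq1.le)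

theorem zeta_single {q : ℝ} (hq : 0 < q) (hq1 : q < 1) :
    1 - ((1 - q : ℝ) : ℂ) • (opZStar q * opZ q) = zetaFun q (fun x => (x : ℂ)) := by
  refine Finsupp.lhom_ext' fun n => LinearMap.ext_ring ?_
  have h1 : (1 : ℝ) - q ≠ 0 := (sub_pos.2 hq1).ne'
  have key : (1 : ℝ) - (1 - q) * (√(qNum q n) * √(qNum q n)) = q ^ n := by
    rw [Real.mul_self_sqrt (qNum_nonneg hq hq1 n), qNum]
    field_simp
    ring
  simp only [LinearMap.comp_apply, Module.End.mul_apply, opZStar, opZ, zetaFun,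
    Finsupp.lsingle_apply, Finsupp.linearCombination_single, one_smul, Finsupp.smul_single,
    smul_eq_mul, LinearMap.sub_apply, LinearMap.smul_apply, Module.End.one_apply]
  rw [← key]
  rcases n with _ | n
  · simp [qNum]
  · simp only [Nat.add_sub_cancel]
    rw [← Finsupp.single_sub]
    push_cast
    rfl

/-- `S` is an adjoint of `T` for the inner product of `ℓ²(ℤ)`. -/
def IsAdj (T S : Module.End ℂ (ℤ →₀ ℂ)) : Prop :=
  ∀ φ ψ : ℤ →₀ ℂ, inner ℂ (toL2 (S φ)) (toL2 ψ) = inner ℂ (toL2 φ) (toL2 (T ψ))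

theorem IsAdj.mul {T S T' S' : Module.End ℂ (ℤ →₀ ℂ)} (h : IsAdj T S) (h' : IsAdj T' S') :
    IsAdj (T * T') (S' * S) := fun φ ψ => by
  rw [Module.End.mul_apply, Module.End.mul_apply, h', h]

theorem IsAdj.neg {T S : Module.End ℂ (ℤ →₀ ℂ)} (h : IsAdj T S) : IsAdj (-T) (-S) := fun φ ψ => by
  simp [h φ ψ]

theorem IsAdj.smul {T S : Module.End ℂ (ℤ →₀ ℂ)} (h : IsAdj T S) (c : ℝ) :
    IsAdj ((c : ℂ) • T) ((c : ℂ) • S) := fun φ ψ => by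
  simp only [LinearMap.smul_apply, map_smul, inner_smul_left, inner_smul_right, h φ ψ,
    Complex.conj_ofReal]

theorem IsAdj.pow {T S : Module.End ℂ (ℤ →₀ ℂ)} (h : IsAdj T S) (n : ℕ) :
    IsAdj (T ^ n) (S ^ n) := by
  induction n with
  | zero => intro φ ψ; simp
  | succ n ih => rw [pow_succ, pow_succ']; exact ih.mul h

theorem isAdj_of_single {T S : Module.End ℂ (ℤ →₀ ℂ)}
    (h : ∀ i k : ℤ, (starRingEnd ℂ) (S (Finsupp.single i 1) k) = T (Finsupp.single k 1) i) :
    IsAdj T S := by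
  have hs : ∀ (i : ℤ) (a : ℂ), Finsupp.single i a = a • Finsupp.single i (1 : ℂ) := by
    intro i a; simp
  have h1 : ∀ (i : ℤ), toL2 (Finsupp.single i 1) = lp.single 2 i (1 : ℂ) := by
    intro i; simp [toL2]
  intro φ ψ
  induction φ using Finsupp.induction_linear with
  | zero => simp
  | add f g hf hg => simp only [map_add, inner_add_left, hf, hg]
  | single i a =>
    induction ψ using Finsupp.induction_linear with
    | zero => simp
    | add f g hf hg => simp only [map_add, inner_add_right, hf, hg]
    | single k b =>
      rw [hs i a, hs k b]
      simp only [map_smul, inner_smul_left, inner_smul_right, h1]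
      rw [lp.inner_single_left, lp.inner_single_right, toL2_apply, toL2_apply]
      simp [h]

theorem isAdj_opAPow (i : ℤ) : IsAdj (opAPow i) (opAPow (-i)) := by
  refine isAdj_of_single fun a b => ?_
  simp only [opAPow, Finsupp.linearCombination_single, one_smul, Finsupp.single_apply]
  have : (a - 2 * -i = b) ↔ (b - 2 * i = a) := by constructor <;> intro h <;> omega
  simp only [this]
  split_ifs <;> simp

theorem isAdj_opB (q : ℝ) : IsAdj (opB q) (opBStar q) := by
  refine isAdj_of_single fun a b => ?_
  simp only [opB, opBStar, Finsupp.linearCombination_single, one_smul, Finsupp.single_apply]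
  by_cases h : a + 1 = b
  · subst h
    simp [Complex.conj_ofReal]
  · have : b - 1 ≠ a := fun h' => h (by omega)
    simp [h, this]

theorem isAdj_opBStar (q : ℝ) : IsAdj (opBStar q) (opB q) := fun φ ψ => by
  rw [← inner_conj_symm, ← isAdj_opB q, inner_conj_symm]

theorem isAdj_etaFun (q : ℝ) (F : ℝ → ℝ) : IsAdj (etaFun q F) (etaFun q F) := by
  refine isAdj_of_single fun a b => ?_
  simp only [etaFun, Finsupp.linearCombination_single, one_smul, Finsupp.single_apply]
  by_cases h : a = b
  · subst h
    simp [Complex.conj_ofReal]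
  · simp [h, Ne.symm h]

/-- `U^*_{ms}` is the adjoint of `U_{sm}`. -/
theorem inner_UStar (q : ℝ) (m s : ℕ) (φ ψ : ℤ →₀ ℂ) :
    inner ℂ (toL2 (UStar q m s φ)) (toL2 ψ) = inner ℂ (toL2 φ) (toL2 (U q s m ψ)) := by
  have hA : IsAdj (opAPow (-(s : ℤ))) (opAPow (s : ℤ)) := by
    simpa using isAdj_opAPow (-(s : ℤ))
  have : IsAdj (U q s m) (UStar q m s) := by
    unfold U UStar
    split_ifs with h
    · rw [mul_assoc (etaFun _ _)]
      exact (hA.mul ((isAdj_opBStar q).pow _)).mul (isAdj_etaFun q _)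
    · rw [mul_assoc (etaFun _ _)]
      exact ((hA.mul ((isAdj_opB q).neg.pow _)).mul (isAdj_etaFun q _)).smul _
  exact this φ ψ

theorem qFact_pos {q : ℝ} (hq : 0 < q) (hq1 : q < 1) (n : ℕ) : 0 < qFact q n :=
  Finset.prod_pos fun k _ =>
    div_pos (sub_pos.2 (pow_lt_one₀ hq.le hq1 (Nat.succ_ne_zero k))) (sub_pos.2 hq1)

theorem summable_qExp {q x : ℝ} (hq : 0 < q) (hq1 : q < 1) (hx : |(1 - q) * x| < 1) :
    Summable fun k : ℕ => x ^ k / qFact q k := by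
  rcases eq_or_ne x 0 with rfl | hx0
  · refine summable_of_ne_finset_zero (s := {0}) fun b hb => ?_
    have : b ≠ 0 := by simpa using hb
    simp [this]
  refine summable_of_ratio_test_tendsto_lt_one (l := |(1 - q) * x|) hx
    (Filter.Eventually.of_forall fun k =>
      div_ne_zero (pow_ne_zero _ hx0) (qFact_pos hq hq1 k).ne') ?_
  have h1 : (1 : ℝ) - q ≠ 0 := (sub_pos.2 hq1).ne'
  have hr : ∀ k : ℕ, ‖x ^ (k + 1) / qFact q (k + 1)‖ / ‖x ^ k / qFact q k‖ =
      |(1 - q) * x / (1 - q ^ (k + 1))| := by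
    intro k
    have hk := (qFact_pos hq hq1 k).ne'
    have h2 : (1 : ℝ) - q ^ (k + 1) ≠ 0 :=
      (sub_pos.2 (pow_lt_one₀ hq.le hq1 (Nat.succ_ne_zero k))).ne'
    have h3 : qFact q (k + 1) = qFact q k * ((1 - q ^ (k + 1)) / (1 - q)) := by
      rw [qFact, Finset.prod_range_succ]; rfl
    rw [← norm_div, Real.norm_eq_abs, h3]
    congr 1
    field_simp
    ring
  simp only [hr]
  have h4 : Filter.Tendsto (fun k : ℕ => q ^ (k + 1)) Filter.atTop (nhds 0) :=
    (tendsto_pow_atTop_nhds_zero_of_lt_one hq.le hq1).comp (Filter.tendsto_add_atTop_nat 1)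
  have h5 : Filter.Tendsto (fun k : ℕ => (1 - q) * x / (1 - q ^ (k + 1))) Filter.atTop
      (nhds ((1 - q) * x / (1 - 0))) :=
    tendsto_const_nhds.div (tendsto_const_nhds.sub h4) (by norm_num)
  simpa using h5.abs

theorem qExp_step {q x : ℝ} (hq : 0 < q) (hq1 : q < 1) (hx : |(1 - q) * x| < 1) :
    (∑' k : ℕ, x ^ k / qFact q k) * (1 - (1 - q) * x) = ∑' k : ℕ, (q * x) ^ k / qFact q k := by
  have h1 : (1 : ℝ) - q ≠ 0 := (sub_pos.2 hq1).ne'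
  have hs := summable_qExp hq hq1 hx
  have hx' : |(1 - q) * (q * x)| < 1 := by
    have : (1 - q) * (q * x) = q * ((1 - q) * x) := by ring
    rw [this, abs_mul, abs_of_pos hq]
    nlinarith [abs_nonneg ((1 - q) * x)]
  have hs' := summable_qExp hq hq1 hx'
  have e : (∑' k : ℕ, x ^ k / qFact q k) - (∑' k : ℕ, (q * x) ^ k / qFact q k) =
      (1 - q) * x * ∑' k : ℕ, x ^ k / qFact q k := by
    rw [← hs.tsum_sub hs', (hs.sub hs').tsum_eq_zero_add, ← tsum_mul_left]
    simp only [pow_zero, sub_self, zero_add]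
    refine tsum_congr fun k => ?_
    have hk := (qFact_pos hq hq1 k).ne'
    have h2 : (1 : ℝ) - q ^ (k + 1) ≠ 0 :=
      (sub_pos.2 (pow_lt_one₀ hq.le hq1 (Nat.succ_ne_zero k))).ne'
    have h3 : qFact q (k + 1) = qFact q k * ((1 - q ^ (k + 1)) / (1 - q)) := by
      rw [qFact, Finset.prod_range_succ]; rfl
    rw [h3, mul_pow]
    field_simp
    ring
  linear_combination e

/-- Inside the disc of convergence `qExp` is the sum of the q-exponential series. -/
theorem hasSum_qExp {q x : ℝ} (hq : 0 < q) (hq1 : q < 1) (hx : |(1 - q) * x| < 1) :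
    HasSum (fun k : ℕ => x ^ k / qFact q k) (qExp q x) := by
  have hs := summable_qExp hq hq1 hx
  have hb : ∀ n : ℕ, |(1 - q) * (q ^ n * x)| < 1 := by
    intro n
    have : (1 - q) * (q ^ n * x) = q ^ n * ((1 - q) * x) := by ring
    rw [this, abs_mul, abs_of_pos (pow_pos hq n)]
    have := pow_le_one₀ (n := n) hq.le hq1.le
    nlinarith [abs_nonneg ((1 - q) * x), pow_pos hq n]
  have hprod : ∀ n : ℕ, (∑' k : ℕ, x ^ k / qFact q k) *
      ∏ i ∈ Finset.range n, (1 - (1 - q) * q ^ i * x) = ∑' k : ℕ, (q ^ n * x) ^ k / qFact q k := by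
    intro n
    induction n with
    | zero => simp
    | succ n ih =>
      rw [Finset.prod_range_succ, ← mul_assoc, ih]
      have := qExp_step hq hq1 (hb n)
      rw [← mul_assoc q, ← pow_succ'] at this
      rw [← this]
      ring
  have hm : Multipliable fun i : ℕ => 1 - (1 - q) * q ^ i * x := by
    have : Summable fun i : ℕ => ‖-((1 - q) * q ^ i * x)‖ := by
      refine Summable.norm (Summable.neg (Summable.mul_right _ (Summable.mul_left _ ?_)))
      exact summable_geometric_of_lt_one hq.le hq1
    simpa [sub_eq_add_neg] using multipliable_one_add_of_summable this
  have hl1 := (hm.hasProd.tendsto_prod_nat).const_mul (∑' k : ℕ, x ^ k / qFact q k)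
  simp only [hprod] at hl1
  have hl2 : Filter.Tendsto (fun n : ℕ => ∑' k : ℕ, (q ^ n * x) ^ k / qFact q k) Filter.atTop
      (nhds (∑' k : ℕ, (0 : ℝ) ^ k / qFact q k)) := by
    refine tendsto_tsum_of_dominated_convergence (bound := fun k => ‖x ^ k / qFact q k‖)
      hs.norm (fun k => ?_) (Filter.Eventually.of_forall fun n k => ?_)
    · have : Filter.Tendsto (fun n : ℕ => q ^ n * x) Filter.atTop (nhds 0) := by
        simpa using (tendsto_pow_atTop_nhds_zero_of_lt_one hq.le hq1).mul_const x
      exact (this.pow k).div_const _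
    · rw [mul_pow, mul_div_assoc, norm_mul]
      refine mul_le_of_le_one_left (norm_nonneg _) ?_
      rw [Real.norm_eq_abs, abs_of_pos (by positivity)]
      exact pow_le_one₀ (by positivity) (pow_le_one₀ hq.le hq1.le)
  have h0 : (∑' k : ℕ, (0 : ℝ) ^ k / qFact q k) = 1 := by
    rw [tsum_eq_single 0]
    · simp [qFact]
    · intro k hk; simp [hk]
  rw [h0] at hl2
  have heq := tendsto_nhds_unique hl1 hl2
  have : qExp q x = ∑' k : ℕ, x ^ k / qFact q k := (eq_inv_of_mul_eq_one_left heq).symm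
  rw [this]
  exact hs.hasSum

end QPlane

end

noncomputable section

namespace QPlane

/-! ### Preliminaries -/

/-! Write `q = h ^ 4`, so that the quarter powers of `q` become integer powers of `h`. Every
operator involved shifts the basis vectors `|k⟩` and multiplies them by a scalar, so both claims are
scalar identities. Up to square-root normalisations the scalars of `U`, `D` and `t` are `vSum`,
`dSum` and `tauSum`, sums of products of reciprocal q-factorials.

Conceptually, `D_j = ∑_p q^((j+2p)²/4) μ^(j+2p) z*^p z^(p+j) / ((p)_q! (p+j)_q!)` with `μ = iλ`, and
the coaction `δ(z*) = B* + A* z*`, `δ(z) = B + A z` sends `D_j` to `∑_i D_i ⊗ t_{ji}`. The vectors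
`|n,k⟩'` form an orthonormal system on which `δ(z*)` and `δ(z)` act as `z*` and `z` do on `|n,k⟩`.
Hence `δ(D_j)` has on the primed vectors the matrix elements that `D_j` has on the Fock space, and
pairing with a primed vector gives (b).

The actions of `δ(z*)` and `δ(z)` are the two recursions `vSum_succ_right` and `vSum_pred_right`,
both q-Pascal identities. The first, started at the ground state, also yields (a). Expanding their
powers by the q-binomial theorem gives `raiseSum_vSum` and `lowerSum_vSum`. In
`hasSum_dSum_mul_tauSum` the series over `l` is evaluated: for fixed powers `p` and `e` in `D` and
`t` the sum over `l` is a power of `δ(z)`, the terms with `p + e` fixed then form a power of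
`δ(z*)`, and what remains is the series of `D_j` itself.

Orthogonality, `pairing_eq`, comes from moving `δ(z*)` to the other side as `δ(z)`, down to the
ground state, whose norm is Euler's sum for `1 / e_q^(-x)`. Only the isometry of `U` is needed. The
interchanges of summation are legitimate because `vSum` decays in `s` faster than any geometric
sequence and `tauTerm` has Gaussian decay in `e`, while `dSum` grows at most geometrically. -/

theorem two_mul_choose_two_add (n : ℕ) : 2 * n.choose 2 + n = n ^ 2 := by
  rw [Nat.choose_two_right, Nat.mul_div_cancel' (Nat.even_mul_pred_self n).two_dvd]
  rcases n with _ | n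
  · rfl
  · simp only [Nat.add_sub_cancel]; ring

theorem two_mul_choose_two_cast (n : ℕ) : (2 * n.choose 2 : ℤ) = (n : ℤ) ^ 2 - n := by
  have h : ((2 * n.choose 2 + n : ℕ) : ℤ) = ((n ^ 2 : ℕ) : ℤ) := by rw [two_mul_choose_two_add]
  push_cast at h
  linarith

/-! ### Reciprocal q-factorials of integers -/

/-- The q-number of an integer. -/
def qInt (q : ℝ) (z : ℤ) : ℝ := (1 - q ^ z) / (1 - q)

/-- The reciprocal `1 / (z)_q!` of the q-factorial, extended by `0` to negative integers. -/
def rfact (q : ℝ) (z : ℤ) : ℝ := if 0 ≤ z then (qFact q z.toNat)⁻¹ else 0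

theorem qInt_natCast (q : ℝ) (n : ℕ) : qInt q n = qNum q n := by
  simp [qInt, qNum]

theorem qInt_zero (q : ℝ) : qInt q 0 = 0 := by simp [qInt]

theorem qInt_add {q : ℝ} (hq : 0 < q) (a b : ℤ) : qInt q (a + b) = qInt q a + q ^ a * qInt q b := by
  rw [qInt, qInt, qInt, zpow_add₀ hq.ne']
  ring

theorem qFact_zero (q : ℝ) : qFact q 0 = 1 := by simp [qFact]

theorem qFact_succ (q : ℝ) (n : ℕ) : qFact q (n + 1) = qFact q n * qNum q (n + 1) := by
  rw [qFact, Finset.prod_range_succ, qFact]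

theorem qNum_succ_pos {q : ℝ} (hq : 0 < q) (hq1 : q < 1) (n : ℕ) : 0 < qNum q (n + 1) :=
  div_pos (sub_pos.2 (pow_lt_one₀ hq.le hq1 (Nat.succ_ne_zero n))) (sub_pos.2 hq1)

theorem rfact_of_neg (q : ℝ) {z : ℤ} (hz : z < 0) : rfact q z = 0 := if_neg (not_le.2 hz)

theorem rfact_natCast (q : ℝ) (n : ℕ) : rfact q n = (qFact q n)⁻¹ := by simp [rfact]

theorem rfact_zero (q : ℝ) : rfact q 0 = 1 := by simp [rfact, qFact]

theorem rfact_nonneg {q : ℝ} (hq : 0 < q) (hq1 : q < 1) (z : ℤ) : 0 ≤ rfact q z := by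
  unfold rfact
  split_ifs
  · exact inv_nonneg.2 (qFact_pos hq hq1 _).le
  · exact le_rfl

theorem one_le_qFact {q : ℝ} (hq : 0 < q) (hq1 : q < 1) (n : ℕ) : 1 ≤ qFact q n := by
  refine Finset.prod_induction _ (fun x : ℝ => 1 ≤ x)
    (fun a b ha hb => one_le_mul_of_one_le_of_one_le ha hb) le_rfl fun k _ => ?_
  rw [qNum, one_le_div (sub_pos.2 hq1), pow_succ]
  have := pow_le_one₀ (n := k) hq.le hq1.le
  nlinarith

theorem rfact_le_one {q : ℝ} (hq : 0 < q) (hq1 : q < 1) (z : ℤ) : rfact q z ≤ 1 := by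
  unfold rfact
  split_ifs
  · exact inv_le_one_of_one_le₀ (one_le_qFact hq hq1 _)
  · exact zero_le_one

/-- Extending the reciprocal factorial by zero makes this valid without exception: at `z = 0` both
sides vanish. Sums may therefore be shifted or lengthened without separate boundary terms. -/
theorem qInt_mul_rfact {q : ℝ} (hq : 0 < q) (hq1 : q < 1) (z : ℤ) :
    qInt q z * rfact q z = rfact q (z - 1) := by
  rcases lt_trichotomy z 0 with hz | rfl | hz
  · rw [rfact_of_neg q hz, rfact_of_neg q (by omega), mul_zero]
  · rw [qInt_zero, zero_mul, rfact_of_neg q (by omega)]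
  · obtain ⟨n, rfl⟩ : ∃ n : ℕ, z = (n : ℤ) + 1 := ⟨(z - 1).toNat, by omega⟩
    rw [add_sub_cancel_right, ← Nat.cast_succ, rfact_natCast, rfact_natCast, qInt_natCast,
      qFact_succ]
    have h1 := (qFact_pos hq hq1 n).ne'
    have h2 := (qNum_succ_pos hq hq1 n).ne'
    field_simp

/-! ### The matrix elements of `U` up to normalisation -/

/-- A summand of `vSum`. -/
def vTerm (h : ℝ) (k s n p : ℤ) : ℝ :=
  rfact (h ^ 4) p * rfact (h ^ 4) (s - p) * rfact (h ^ 4) (n - p) *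
    ((-1) ^ (s - p) * h ^ ((s + n - 2 * p) ^ 2 + (n - s) + 2 * k * (s + n - 2 * p)))

/-- The matrix element `⟨s, k + s + n | U | n, k⟩` for `q = h ^ 4`, divided by
`√((s)_q! (n)_q! e_q^{-q^k})`. -/
def vSum (h : ℝ) (k s n : ℤ) : ℝ := ∑ p ∈ Finset.range (n.toNat + 1), vTerm h k s n p

theorem vSum_eq_sum (h : ℝ) (k s n : ℤ) {P : ℕ} (hP : n ≤ P) :
    vSum h k s n = ∑ p ∈ Finset.range (P + 1), vTerm h k s n p := by
  refine Finset.sum_subset (fun p hp => ?_) fun p _ hp => ?_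
  · simp only [Finset.mem_range] at hp ⊢; omega
  · simp only [Finset.mem_range] at hp
    rw [vTerm, rfact_of_neg _ (show n - (p : ℤ) < 0 by omega)]
    ring

theorem vSum_of_neg_right (h : ℝ) (k s : ℤ) {n : ℤ} (hn : n < 0) : vSum h k s n = 0 := by
  refine Finset.sum_eq_zero fun p _ => ?_
  rw [vTerm, rfact_of_neg _ (show n - (p : ℤ) < 0 by omega)]
  ring

theorem vSum_of_neg_left (h : ℝ) (k n : ℤ) {s : ℤ} (hs : s < 0) : vSum h k s n = 0 := by
  refine Finset.sum_eq_zero fun p _ => ?_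
  rw [vTerm, rfact_of_neg _ (show s - (p : ℤ) < 0 by omega)]
  ring

theorem vSum_zero_right (h : ℝ) (k s : ℤ) :
    vSum h k s 0 = rfact (h ^ 4) s * ((-1) ^ s * h ^ (s ^ 2 - s + 2 * k * s)) := by
  rw [vSum, Int.toNat_zero, zero_add, Finset.sum_range_one, vTerm]
  simp only [Nat.cast_zero, sub_zero, rfact_zero, one_mul, mul_one, mul_zero, add_zero, zero_sub,
    ← sub_eq_add_neg]


theorem pow_four_zpow (h : ℝ) (z : ℤ) : (h ^ 4) ^ z = h ^ (4 * z) := by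
  rw [zpow_mul]; norm_cast

/-- Matrix form of `δ(z*) |n,k⟩' = √(n+1)_q |n+1,k⟩'`. Split `(n+1)_q = (p)_q + q^p (n+1-p)_q` in
each summand: one part lowers the factorial of `p` and, after `p ↦ p - 1`, gives the term in `s -
1`; the other lowers that of `n + 1 - p`. -/
theorem vSum_succ_right {h : ℝ} (h0 : 0 < h) (h1 : h < 1) (k s n : ℤ) :
    qInt (h ^ 4) (n + 1) * vSum h k s (n + 1) =
      h ^ (2 * (k + n + s + 1)) * vSum h k s n + vSum h k (s - 1) n := by
  have hq : 0 < h ^ 4 := by positivity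
  have hq1 : h ^ 4 < 1 := pow_lt_one₀ h0.le h1 (by norm_num)
  set P : ℕ := (n + 1).toNat
  have e1 := vSum_eq_sum h k s (n + 1) (P := P + 1) (by omega)
  have e2 := vSum_eq_sum h k s n (P := P + 1) (by omega)
  have e3 := vSum_eq_sum h k (s - 1) n (P := P) (by omega)
  have key : ∀ p : ℤ, qInt (h ^ 4) (n + 1) * vTerm h k s (n + 1) p =
      h ^ (2 * (k + n + s + 1)) * vTerm h k s n p + vTerm h k (s - 1) n (p - 1) := by
    intro p
    have a1 := qInt_add hq p (n + 1 - p)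
    have a2 := qInt_mul_rfact hq hq1 p
    have a3 := qInt_mul_rfact hq hq1 (n + 1 - p)
    rw [add_sub_cancel, pow_four_zpow h] at a1
    rw [show n + 1 - p - 1 = n - p by ring] at a3
    have a4 : h ^ (4 * p) * h ^ ((s + (n + 1) - 2 * p) ^ 2 + (n + 1 - s) +
        2 * k * (s + (n + 1) - 2 * p)) = h ^ (2 * (k + n + s + 1)) *
        h ^ ((s + n - 2 * p) ^ 2 + (n - s) + 2 * k * (s + n - 2 * p)) := by
      rw [← zpow_add₀ h0.ne', ← zpow_add₀ h0.ne']
      congr 1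
      ring
    simp only [vTerm]
    rw [show s - 1 - (p - 1) = s - p by ring, show n - (p - 1) = n + 1 - p by ring, ← a2, ← a3,
      a1, show (s - 1 + n - 2 * (p - 1)) = s + (n + 1) - 2 * p by ring,
      show n - (s - 1) = n + 1 - s by ring]
    linear_combination (rfact (h ^ 4) p * rfact (h ^ 4) (s - p) * rfact (h ^ 4) (n + 1 - p) *
      (-1) ^ (s - p) * qInt (h ^ 4) (n + 1 - p)) * a4
  rw [e1, e2, e3, Finset.mul_sum, Finset.mul_sum, Finset.sum_congr rfl fun (p : ℕ) _ => key p,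
    Finset.sum_add_distrib]
  congr 1
  rw [Finset.sum_range_succ']
  have : vTerm h k (s - 1) n (((0 : ℕ) : ℤ) - 1) = 0 := by
    rw [vTerm, rfact_of_neg _ (by simp)]
    ring
  rw [this, add_zero]
  refine Finset.sum_congr rfl fun p _ => ?_
  rw [Nat.cast_succ, add_sub_cancel_right]

/-- Matrix form of `δ(z) |n,k⟩' = √(n)_q |n-1,k⟩'` for `δ(z) = B + A z`. With `(s+1)_q = (p)_q + q^p
(s+1-p)_q`, the second part cancels the first term on the left because of the alternating sign, and
the first part is the right-hand side with `p` shifted. -/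
theorem vSum_pred_right {h : ℝ} (h0 : 0 < h) (h1 : h < 1) (k s n : ℤ) :
    h ^ (2 * (k + n + s)) * vSum h k s n + qInt (h ^ 4) (s + 1) * vSum h k (s + 1) n =
      vSum h k s (n - 1) := by
  have hq : 0 < h ^ 4 := by positivity
  have hq1 : h ^ 4 < 1 := pow_lt_one₀ h0.le h1 (by norm_num)
  set P : ℕ := n.toNat
  have e1 := vSum_eq_sum h k s n (P := P + 1) (by omega)
  have e2 := vSum_eq_sum h k (s + 1) n (P := P + 1) (by omega)
  have e3 := vSum_eq_sum h k s (n - 1) (P := P) (by omega)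
  have key : ∀ p : ℤ, h ^ (2 * (k + n + s)) * vTerm h k s n p +
      qInt (h ^ 4) (s + 1) * vTerm h k (s + 1) n p = vTerm h k s (n - 1) (p - 1) := by
    intro p
    have a1 := qInt_add hq p (s + 1 - p)
    have a2 := qInt_mul_rfact hq hq1 p
    have a3 := qInt_mul_rfact hq hq1 (s + 1 - p)
    rw [add_sub_cancel, pow_four_zpow h] at a1
    rw [show s + 1 - p - 1 = s - p by ring] at a3
    have a4 : h ^ (4 * p) * h ^ ((s + 1 + n - 2 * p) ^ 2 + (n - (s + 1)) +
        2 * k * (s + 1 + n - 2 * p)) = h ^ (2 * (k + n + s)) *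
        h ^ ((s + n - 2 * p) ^ 2 + (n - s) + 2 * k * (s + n - 2 * p)) := by
      rw [← zpow_add₀ h0.ne', ← zpow_add₀ h0.ne']
      congr 1
      ring
    have a5 : (-1 : ℝ) ^ (s + 1 - p) = -(-1) ^ (s - p) := by
      rw [show s + 1 - p = s - p + 1 by ring, zpow_add₀ (by norm_num)]
      simp
    simp only [vTerm]
    rw [show s - (p - 1) = s + 1 - p by ring, show n - 1 - (p - 1) = n - p by ring, ← a2, ← a3,
      a1, show (s + (n - 1) - 2 * (p - 1)) = s + 1 + n - 2 * p by ring,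
      show n - 1 - s = n - (s + 1) by ring, a5]
    linear_combination (-rfact (h ^ 4) p * rfact (h ^ 4) (s + 1 - p) * rfact (h ^ 4) (n - p) *
      (-1) ^ (s - p) * qInt (h ^ 4) (s + 1 - p)) * a4
  rw [e1, e2, e3, Finset.mul_sum, Finset.mul_sum, ← Finset.sum_add_distrib,
    Finset.sum_congr rfl fun (p : ℕ) _ => key p, Finset.sum_range_succ']
  have : vTerm h k s (n - 1) (((0 : ℕ) : ℤ) - 1) = 0 := by
    rw [vTerm, rfact_of_neg _ (by simp)]
    ring
  rw [this, add_zero]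
  refine Finset.sum_congr rfl fun p _ => ?_
  rw [Nat.cast_succ, add_sub_cancel_right]

/-! ### Powers of the lowering and raising recursions -/

/-- The `b`-th divided power of `φ ↦ (s ↦ h^(2(c+s)) φ s + φ (s + 1))`, with `c` decreasing by one
at each step. -/
def lowerSum (h : ℝ) (c : ℤ) (φ : ℤ → ℝ) (b : ℕ) (s : ℤ) : ℝ :=
  ∑ r ∈ Finset.range (b + 1), h ^ (2 * (b - r) * (c + s - r) - (b - r) * (b - r - 1) : ℤ) *
    (rfact (h ^ 4) r * rfact (h ^ 4) (b - r) * φ (s + r))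

/-- The `a`-th divided power of `φ ↦ (s ↦ h^(2(c+s+1)) φ s + φ (s - 1))`, with `c` increasing by
one at each step. -/
def raiseSum (h : ℝ) (c : ℤ) (φ : ℤ → ℝ) (a : ℕ) (s : ℤ) : ℝ :=
  ∑ p ∈ Finset.range (a + 1), h ^ (2 * (a - p) * (c + s - p) + (a - p) * (a - p + 1) : ℤ) *
    (rfact (h ^ 4) p * rfact (h ^ 4) (a - p) * φ (s - p))

/-- The induction step of a q-binomial theorem, obtained from `(b+1)_q = (b+1-r)_q + q^(b+1-r)
(r)_q`. In `raiseSum_succ` the splitting is `(a+1)_q = (p)_q + q^p (a+1-p)_q`. -/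
theorem lowerSum_succ {h : ℝ} (h0 : 0 < h) (h1 : h < 1) (c : ℤ) (φ : ℤ → ℝ) (b : ℕ) (s : ℤ) :
    qInt (h ^ 4) (b + 1) * lowerSum h c φ (b + 1) s =
      h ^ (2 * (c - b + s)) * lowerSum h c φ b s + lowerSum h c φ b (s + 1) := by
  have hq : 0 < h ^ 4 := by positivity
  have hq1 : h ^ 4 < 1 := pow_lt_one₀ h0.le h1 (by norm_num)
  set T : ℤ → ℤ → ℤ → ℝ := fun b s r =>
    h ^ (2 * (b - r) * (c + s - r) - (b - r) * (b - r - 1) : ℤ) *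
    (rfact (h ^ 4) r * rfact (h ^ 4) (b - r) * φ (s + r)) with hT
  have e1 : lowerSum h c φ b s = ∑ r ∈ Finset.range (b + 1 + 1), T b s (r : ℕ) := by
    rw [Finset.sum_range_succ]
    have : T b s ((b + 1 : ℕ) : ℤ) = 0 := by
      simp only [hT]
      rw [rfact_of_neg _ (show (b : ℤ) - (b + 1 : ℕ) < 0 by push_cast; omega)]
      ring
    rw [this, add_zero]
    rfl
  have key : ∀ r : ℤ, qInt (h ^ 4) (b + 1) * T (b + 1) s r =
      h ^ (2 * (c - b + s)) * T b s r + T b (s + 1) (r - 1) := by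
    intro r
    have a1 := qInt_add hq (b + 1 - r) r
    have a2 := qInt_mul_rfact hq hq1 r
    have a3 := qInt_mul_rfact hq hq1 (b + 1 - r)
    rw [sub_add_cancel, pow_four_zpow h] at a1
    rw [show (b : ℤ) + 1 - r - 1 = b - r by ring] at a3
    have a4 : h ^ (2 * (b + 1 - r) * (c + s - r) - (b + 1 - r) * (b + 1 - r - 1) : ℤ) =
        h ^ (2 * (c - b + s)) * h ^ (2 * (b - r) * (c + s - r) - (b - r) * (b - r - 1) : ℤ) := by
      rw [← zpow_add₀ h0.ne']
      congr 1
      ring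
    have a5 : h ^ (2 * (b - (r - 1)) * (c + (s + 1) - (r - 1)) -
        (b - (r - 1)) * (b - (r - 1) - 1) : ℤ) = h ^ (4 * (b + 1 - r)) *
        h ^ (2 * (b + 1 - r) * (c + s - r) - (b + 1 - r) * (b + 1 - r - 1) : ℤ) := by
      rw [← zpow_add₀ h0.ne']
      congr 1
      ring
    simp only [hT]
    rw [a5, show s + 1 + (r - 1) = s + r by ring, show (b : ℤ) - (r - 1) = b + 1 - r by ring, ← a2,
      ← a3, a1]
    linear_combination (rfact (h ^ 4) r * rfact (h ^ 4) (b + 1 - r) * qInt (h ^ 4) (b + 1 - r) *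
      φ (s + r)) * a4
  have e2 : lowerSum h c φ (b + 1) s = ∑ r ∈ Finset.range (b + 1 + 1), T (b + 1) s (r : ℕ) := by
    simp only [lowerSum, hT, Nat.cast_succ]
  rw [e1, e2, Finset.mul_sum, Finset.mul_sum, Finset.sum_congr rfl fun (r : ℕ) _ => key r,
    Finset.sum_add_distrib]
  congr 1
  rw [Finset.sum_range_succ']
  have : T b (s + 1) (((0 : ℕ) : ℤ) - 1) = 0 := by
    simp only [hT]
    rw [rfact_of_neg _ (show ((0 : ℕ) : ℤ) - 1 < 0 by simp)]
    ring
  rw [this, add_zero]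
  refine Finset.sum_congr rfl fun r _ => ?_
  rw [Nat.cast_succ, add_sub_cancel_right]

theorem raiseSum_succ {h : ℝ} (h0 : 0 < h) (h1 : h < 1) (c : ℤ) (φ : ℤ → ℝ) (a : ℕ) (s : ℤ) :
    qInt (h ^ 4) (a + 1) * raiseSum h c φ (a + 1) s =
      h ^ (2 * (c + a + s + 1)) * raiseSum h c φ a s + raiseSum h c φ a (s - 1) := by
  have hq : 0 < h ^ 4 := by positivity
  have hq1 : h ^ 4 < 1 := pow_lt_one₀ h0.le h1 (by norm_num)
  set T : ℤ → ℤ → ℤ → ℝ := fun a s p =>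
    h ^ (2 * (a - p) * (c + s - p) + (a - p) * (a - p + 1) : ℤ) *
    (rfact (h ^ 4) p * rfact (h ^ 4) (a - p) * φ (s - p)) with hT
  have e1 : raiseSum h c φ a s = ∑ p ∈ Finset.range (a + 1 + 1), T a s (p : ℕ) := by
    rw [Finset.sum_range_succ]
    have : T a s ((a + 1 : ℕ) : ℤ) = 0 := by
      simp only [hT]
      rw [rfact_of_neg _ (show (a : ℤ) - (a + 1 : ℕ) < 0 by push_cast; omega)]
      ring
    rw [this, add_zero]
    rfl
  have key : ∀ p : ℤ, qInt (h ^ 4) (a + 1) * T (a + 1) s p =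
      h ^ (2 * (c + a + s + 1)) * T a s p + T a (s - 1) (p - 1) := by
    intro p
    have a1 := qInt_add hq p (a + 1 - p)
    have a2 := qInt_mul_rfact hq hq1 p
    have a3 := qInt_mul_rfact hq hq1 (a + 1 - p)
    rw [add_sub_cancel, pow_four_zpow h] at a1
    rw [show (a : ℤ) + 1 - p - 1 = a - p by ring] at a3
    have a4 : h ^ (4 * p) * h ^ (2 * (a + 1 - p) * (c + s - p) + (a + 1 - p) * (a + 1 - p + 1) : ℤ) =
        h ^ (2 * (c + a + s + 1)) *
          h ^ (2 * (a - p) * (c + s - p) + (a - p) * (a - p + 1) : ℤ) := by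
      rw [← zpow_add₀ h0.ne', ← zpow_add₀ h0.ne']
      congr 1
      ring
    simp only [hT]
    rw [show c + (s - 1) - (p - 1) = c + s - p by ring, show s - 1 - (p - 1) = s - p by ring,
      show (a : ℤ) - (p - 1) = a + 1 - p by ring, ← a2, ← a3, a1]
    linear_combination (rfact (h ^ 4) p * rfact (h ^ 4) (a + 1 - p) * qInt (h ^ 4) (a + 1 - p) *
      φ (s - p)) * a4
  have e2 : raiseSum h c φ (a + 1) s = ∑ p ∈ Finset.range (a + 1 + 1), T (a + 1) s (p : ℕ) := by
    simp only [raiseSum, hT, Nat.cast_succ]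
  rw [e1, e2, Finset.mul_sum, Finset.mul_sum, Finset.sum_congr rfl fun (p : ℕ) _ => key p,
    Finset.sum_add_distrib]
  congr 1
  rw [Finset.sum_range_succ']
  have : T a (s - 1) (((0 : ℕ) : ℤ) - 1) = 0 := by
    simp only [hT]
    rw [rfact_of_neg _ (show ((0 : ℕ) : ℤ) - 1 < 0 by simp)]
    ring
  rw [this, add_zero]
  refine Finset.sum_congr rfl fun p _ => ?_
  rw [Nat.cast_succ, add_sub_cancel_right]

theorem qInt_succ_ne_zero {q : ℝ} (hq : 0 < q) (hq1 : q < 1) (n : ℕ) : qInt q (n + 1) ≠ 0 := by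
  rw [← Nat.cast_succ, qInt_natCast]
  exact (qNum_succ_pos hq hq1 n).ne'

theorem qFact_toNat_add_one {q : ℝ} {z : ℤ} (hz : 0 ≤ z) :
    qFact q (z + 1).toNat = qFact q z.toNat * qInt q (z + 1) := by
  obtain ⟨n, rfl⟩ := Int.eq_ofNat_of_zero_le hz
  rw [← Nat.cast_succ, qInt_natCast, Int.toNat_natCast, Int.toNat_natCast, qFact_succ]

/-- The weight `(z)_q!` absorbs the factor `(s+1)_q` of `vSum_pred_right`, so one lowering step
takes the column `n` exactly to the column `n - 1`. The parameter `k + n` decreases along with `n`,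
as in the definition of `lowerSum`. -/
theorem lowerSum_vSum {h : ℝ} (h0 : 0 < h) (h1 : h < 1) (k n : ℤ) (b : ℕ) {s : ℤ} (hs : 0 ≤ s) :
    lowerSum h (k + n) (fun z => qFact (h ^ 4) z.toNat * vSum h k z n) b s =
      qFact (h ^ 4) s.toNat * rfact (h ^ 4) b * vSum h k s (n - b) := by
  have hq : 0 < h ^ 4 := by positivity
  have hq1 : h ^ 4 < 1 := pow_lt_one₀ h0.le h1 (by norm_num)
  induction b generalizing s with
  | zero => simp [lowerSum, rfact_zero]
  | succ b ih =>
    refine mul_left_cancel₀ (qInt_succ_ne_zero hq hq1 b) ?_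
    rw [lowerSum_succ h0 h1, ih hs, ih (by omega), qFact_toNat_add_one hs]
    have a1 := vSum_pred_right h0 h1 k s (n - b)
    have a2 := qInt_mul_rfact hq hq1 (b + 1)
    rw [add_sub_cancel_right] at a2
    push_cast
    rw [show n - (b + 1 : ℤ) = n - b - 1 by ring, ← a1, ← a2,
      show k + n - b + s = k + (n - b) + s by ring]
    ring

/-- Iteration of `vSum_succ_right`. No weight in `s` is needed here; the factors `(n+1)_q, (n+2)_q,
…` accumulate to the quotient of factorials. -/
theorem raiseSum_vSum {h : ℝ} (h0 : 0 < h) (h1 : h < 1) (k : ℤ) {n : ℤ} (hn : 0 ≤ n) (a : ℕ)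
    (s : ℤ) : raiseSum h (k + n) (fun z => vSum h k z n) a s =
      qFact (h ^ 4) (n + a).toNat * rfact (h ^ 4) n * rfact (h ^ 4) a * vSum h k s (n + a) := by
  have hq : 0 < h ^ 4 := by positivity
  have hq1 : h ^ 4 < 1 := pow_lt_one₀ h0.le h1 (by norm_num)
  induction a generalizing s with
  | zero =>
    obtain ⟨m, rfl⟩ := Int.eq_ofNat_of_zero_le hn
    simp [raiseSum, rfact_zero, rfact_natCast, qFact_zero, (qFact_pos hq hq1 m).ne']
  | succ a ih =>
    refine mul_left_cancel₀ (qInt_succ_ne_zero hq hq1 a) ?_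
    have a1 := vSum_succ_right h0 h1 k s (n + a)
    have a2 := qInt_mul_rfact hq hq1 (a + 1)
    rw [add_sub_cancel_right] at a2
    rw [raiseSum_succ h0 h1, ih, ih]
    push_cast
    rw [← add_assoc n, qFact_toNat_add_one (by omega), ← a2]
    rw [show k + (n + a) + s + 1 = k + n + a + s + 1 by ring] at a1
    linear_combination (-qFact (h ^ 4) (n + a).toNat * rfact (h ^ 4) n * qInt (h ^ 4) (a + 1) *
      rfact (h ^ 4) (a + 1)) * a1

/-! ### Rapid decay -/

theorem summable_pow_mul_pow_sq {h : ℝ} (h0 : 0 < h) (h1 : h < 1) {R : ℝ} (hR : 0 < R) :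
    Summable fun n : ℕ => R ^ n * h ^ n ^ 2 := by
  refine summable_of_ratio_test_tendsto_lt_one (l := 0) zero_lt_one
    (Filter.Eventually.of_forall fun n => by positivity) ?_
  have : ∀ n : ℕ, ‖R ^ (n + 1) * h ^ (n + 1) ^ 2‖ / ‖R ^ n * h ^ n ^ 2‖ = R * h * (h ^ 2) ^ n := by
    intro n
    rw [Real.norm_of_nonneg (by positivity), Real.norm_of_nonneg (by positivity),
      div_eq_iff (by positivity), ← pow_mul]
    ring
  simp only [this]
  have h2 := tendsto_pow_atTop_nhds_zero_of_lt_one (r := h ^ 2) (by positivity)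
    (pow_lt_one₀ h0.le h1 (by norm_num))
  simpa using h2.const_mul (R * h)

/-- The column `n = 0` is a single term of size `h^(s²)` up to a geometric factor. The recursion in
`n` preserves summability against all geometric weights simultaneously, which is why `R` varies in
the induction. -/
theorem summable_pow_mul_vSum {h : ℝ} (h0 : 0 < h) (h1 : h < 1) (k : ℤ) (n : ℕ) {R : ℝ}
    (hR : 0 < R) : Summable fun s : ℕ => R ^ s * |vSum h k s n| := by
  have hq : 0 < h ^ 4 := by positivity
  have hq1 : h ^ 4 < 1 := pow_lt_one₀ h0.le h1 (by norm_num)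
  induction n generalizing R with
  | zero =>
    have hR' : 0 < R * h ^ (2 * k - 1) := by positivity
    refine Summable.of_nonneg_of_le (fun s => by positivity) (fun s => ?_)
      (summable_pow_mul_pow_sq h0 h1 hR')
    have e : h ^ ((s : ℤ) ^ 2 - s + 2 * k * s) = (h ^ (2 * k - 1)) ^ s * h ^ s ^ 2 := by
      rw [← zpow_natCast, ← zpow_natCast, ← zpow_mul, ← zpow_add₀ h0.ne']
      congr 1
      push_cast
      ring
    rw [Nat.cast_zero, vSum_zero_right, abs_mul, abs_mul, abs_zpow, abs_neg, abs_one, one_zpow,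
      one_mul, abs_of_nonneg (rfact_nonneg hq hq1 _), abs_of_pos (zpow_pos h0 _), e, mul_pow]
    have := rfact_le_one hq hq1 s
    have h3 : 0 < R ^ s * ((h ^ (2 * k - 1)) ^ s * h ^ s ^ 2) := by positivity
    nlinarith
  | succ n ih =>
    have hpos : 0 < qInt (h ^ 4) (n + 1) := by
      rw [← Nat.cast_succ, qInt_natCast]; exact qNum_succ_pos hq hq1 n
    have s1 : Summable fun s : ℕ => (qInt (h ^ 4) (n + 1))⁻¹ * (h ^ (2 * (k + n + 1)) *
        ((R * h ^ 2) ^ s * |vSum h k s n|) + R ^ s * |vSum h k (s - 1) n|) := by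
      refine Summable.mul_left _ (Summable.add ((ih (by positivity)).mul_left _) ?_)
      rw [← summable_nat_add_iff 1]
      have := (ih hR).mul_left R
      refine this.congr fun s => ?_
      push_cast
      rw [add_sub_cancel_right]
      ring
    refine Summable.of_nonneg_of_le (fun s => by positivity) (fun s => ?_) s1
    rw [inv_mul_eq_div, le_div_iff₀ hpos]
    have e : R ^ s * |vSum h k s (n + 1 : ℕ)| * qInt (h ^ 4) (n + 1) =
        R ^ s * |qInt (h ^ 4) (n + 1) * vSum h k s (n + 1)| := by
      rw [abs_mul, abs_of_pos hpos]
      push_cast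
      ring
    have e2 : h ^ (2 * (k + n + s + 1)) = h ^ (2 * (k + n + 1)) * (h ^ 2) ^ s := by
      rw [← pow_mul, ← zpow_natCast, ← zpow_add₀ h0.ne']
      congr 1
      push_cast
      ring
    rw [e, vSum_succ_right h0 h1, e2, mul_pow]
    calc R ^ s * |h ^ (2 * (k + n + 1)) * (h ^ 2) ^ s * vSum h k s n + vSum h k (s - 1) n|
        ≤ R ^ s * (|h ^ (2 * (k + n + 1)) * (h ^ 2) ^ s * vSum h k s n| + |vSum h k (s - 1) n|) := by
          gcongr; exact abs_add_le _ _
      _ = _ := by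
          rw [abs_mul, abs_of_pos (show 0 < h ^ (2 * (k + n + 1)) * (h ^ 2) ^ s by positivity)]
          ring

theorem qFact_le_pow {q : ℝ} (hq : 0 < q) (hq1 : q < 1) (n : ℕ) : qFact q n ≤ ((1 - q)⁻¹) ^ n := by
  rw [qFact, ← Finset.card_range n, ← Finset.prod_const, Finset.card_range]
  refine Finset.prod_le_prod (fun k _ => (qNum_succ_pos hq hq1 k).le) fun k _ => ?_
  rw [qNum, ← one_div]
  have : 0 < 1 - q := sub_pos.2 hq1
  gcongr
  linarith [pow_pos hq (k + 1)]

theorem summable_pow_mul_qFact_mul_vSum {h : ℝ} (h0 : 0 < h) (h1 : h < 1) (k : ℤ) (n : ℕ) {R : ℝ}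
    (hR : 0 < R) : Summable fun s : ℕ => R ^ s * (qFact (h ^ 4) s * |vSum h k s n|) := by
  have hq : 0 < h ^ 4 := by positivity
  have hq1 : h ^ 4 < 1 := pow_lt_one₀ h0.le h1 (by norm_num)
  have : 0 < 1 - h ^ 4 := sub_pos.2 hq1
  refine Summable.of_nonneg_of_le (fun s => ?_) (fun s => ?_)
    (summable_pow_mul_vSum h0 h1 k n (R := R * (1 - h ^ 4)⁻¹) (by positivity))
  · have := (qFact_pos hq hq1 s).le
    positivity
  · rw [mul_pow, mul_assoc]
    gcongr
    exact qFact_le_pow hq hq1 s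

/-! ### The matrix elements of `D_j` and `t_{ij}` as sums -/

/-- A summand of `dSum`. -/
def dTerm (h : ℝ) (μ : ℂ) (s l p : ℤ) : ℂ :=
  ((rfact (h ^ 4) p * rfact (h ^ 4) (s - p) * rfact (h ^ 4) (l - s + p) *
    h ^ ((l - s + 2 * p) ^ 2) : ℝ) : ℂ) * μ ^ (l - s + 2 * p).toNat

/-- The matrix element `⟨s| D_{l-s} |l⟩` divided by `√((s)_q! (l)_q!)`, with `q = h ^ 4` and
`μ = iλ`. -/
def dSum (h : ℝ) (μ : ℂ) (s l : ℤ) : ℂ := ∑ p ∈ Finset.range (s.toNat + 1), dTerm h μ s l p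

/-- A summand of `tauSum`. -/
def tauTerm (h : ℝ) (μ : ℂ) (d κ : ℤ) (e : ℕ) : ℂ :=
  ((rfact (h ^ 4) e * rfact (h ^ 4) (e + d) *
    h ^ (2 * (e : ℤ) ^ 2 + (2 * e + d) * (1 + 2 * κ)) : ℝ) : ℂ) * μ ^ (2 * e + d).toNat

/-- The matrix element of `t_{j,j-d}` at the vector `|κ + j - d⟩`, with `q = h ^ 4` and
`μ = iλ`. -/
def tauSum (h : ℝ) (μ : ℂ) (d κ : ℤ) : ℂ := ∑' e : ℕ, tauTerm h μ d κ e

/-- The bound is uniform over `κ ≥ c` and `d ≤ N`, since in the double series `κ = k + n + s` and `d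
= j - l + s` vary with the summation indices. The powers of `μ` and of `h^(1+2κ)` each cost at most
`R^(2e+N)`, and `h^(2e²)` remains for convergence. -/
theorem norm_tauTerm_le {h : ℝ} (h0 : 0 < h) (h1 : h < 1) {μ : ℂ} {R : ℝ} (hR : 1 ≤ R)
    (hμ : ‖μ‖ ≤ R) {d κ c : ℤ} (hc : c ≤ κ) (hcR : h ^ (1 + 2 * c) ≤ R) {N : ℕ} (hN : d ≤ N)
    (e : ℕ) : ‖tauTerm h μ d κ e‖ ≤ (R ^ 2) ^ N * ((R ^ 4) ^ e * (h ^ 2) ^ e ^ 2) := by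
  have hq : 0 < h ^ 4 := by positivity
  have hq1 : h ^ 4 < 1 := pow_lt_one₀ h0.le h1 (by norm_num)
  have hpos : 0 ≤ (R ^ 2) ^ N * ((R ^ 4) ^ e * (h ^ 2) ^ e ^ 2) := by positivity
  rcases lt_or_ge ((e : ℤ) + d) 0 with hd | hd
  · rw [tauTerm, rfact_of_neg _ hd]
    simpa using hpos
  obtain ⟨M, hM⟩ : ∃ M : ℕ, (2 * e + d : ℤ) = M := ⟨(2 * e + d).toNat, by omega⟩
  have hMN : M ≤ 2 * e + N := by omega
  have e1 : h ^ (2 * (e : ℤ) ^ 2 + M * (1 + 2 * κ)) = (h ^ 2) ^ e ^ 2 * (h ^ (1 + 2 * κ)) ^ M := by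
    rw [← pow_mul, ← zpow_natCast, ← zpow_natCast, ← zpow_mul, ← zpow_add₀ h0.ne']
    congr 1
    push_cast
    ring
  have e2 : (h ^ (1 + 2 * κ)) ^ M ≤ R ^ (2 * e + N) := by
    refine (pow_le_pow_left₀ (by positivity) ?_ M).trans (pow_le_pow_right₀ hR hMN)
    exact (zpow_le_zpow_right_of_le_one₀ h0 h1.le (by omega)).trans hcR
  have e3 : ‖μ‖ ^ M ≤ R ^ (2 * e + N) :=
    (pow_le_pow_left₀ (norm_nonneg _) hμ M).trans (pow_le_pow_right₀ hR hMN)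
  rw [tauTerm, hM, e1, norm_mul, norm_pow, Int.toNat_natCast, Complex.norm_real, Real.norm_eq_abs,
    abs_mul, abs_mul, abs_of_nonneg (rfact_nonneg hq hq1 _), abs_of_nonneg (rfact_nonneg hq hq1 _),
    abs_of_pos (show 0 < (h ^ 2) ^ e ^ 2 * (h ^ (1 + 2 * κ)) ^ M by positivity)]
  have r1 := rfact_le_one hq hq1 (e : ℤ)
  have r2 := rfact_le_one hq hq1 (e + d : ℤ)
  have r3 := rfact_nonneg hq hq1 (e : ℤ)
  have r4 := rfact_nonneg hq hq1 (e + d : ℤ)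
  calc rfact (h ^ 4) e * rfact (h ^ 4) (e + d) * ((h ^ 2) ^ e ^ 2 * (h ^ (1 + 2 * κ)) ^ M) * ‖μ‖ ^ M
      ≤ 1 * 1 * ((h ^ 2) ^ e ^ 2 * R ^ (2 * e + N)) * R ^ (2 * e + N) := by gcongr
    _ = _ := by ring

theorem summable_pow_four_mul {h : ℝ} (h0 : 0 < h) (h1 : h < 1) {R : ℝ} (hR : 1 ≤ R) :
    Summable fun e : ℕ => (R ^ 4) ^ e * (h ^ 2) ^ e ^ 2 :=
  summable_pow_mul_pow_sq (by positivity) (pow_lt_one₀ h0.le h1 (by norm_num)) (by positivity)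

theorem norm_dTerm_le {h : ℝ} (h0 : 0 < h) (h1 : h < 1) {μ : ℂ} {R : ℝ} (hR : 1 ≤ R)
    (hμ : ‖μ‖ ≤ R) {s l p : ℕ} (hp : p ≤ s) : ‖dTerm h μ s l p‖ ≤ R ^ (l + 2 * s) := by
  have hq : 0 < h ^ 4 := by positivity
  have hq1 : h ^ 4 < 1 := pow_lt_one₀ h0.le h1 (by norm_num)
  have e3 : ‖μ‖ ^ ((l : ℤ) - s + 2 * p).toNat ≤ R ^ (l + 2 * s) :=
    (pow_le_pow_left₀ (norm_nonneg _) hμ _).trans (pow_le_pow_right₀ hR (by omega))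
  have e4 : h ^ (((l : ℤ) - s + 2 * p) ^ 2) ≤ 1 := by
    have := zpow_le_zpow_right_of_le_one₀ h0 h1.le (sq_nonneg ((l : ℤ) - s + 2 * p))
    rwa [zpow_zero] at this
  rw [dTerm, norm_mul, norm_pow, Complex.norm_real, Real.norm_eq_abs, abs_mul, abs_mul, abs_mul,
    abs_of_nonneg (rfact_nonneg hq hq1 _), abs_of_nonneg (rfact_nonneg hq hq1 _),
    abs_of_nonneg (rfact_nonneg hq hq1 _), abs_of_pos (zpow_pos h0 _)]
  have r1 := rfact_le_one hq hq1 (p : ℤ)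
  have r2 := rfact_le_one hq hq1 (s - p : ℤ)
  have r3 := rfact_le_one hq hq1 (l - s + p : ℤ)
  have r4 := rfact_nonneg hq hq1 (p : ℤ)
  have r5 := rfact_nonneg hq hq1 (s - p : ℤ)
  have r6 := rfact_nonneg hq hq1 (l - s + p : ℤ)
  calc _ ≤ (1 * 1 * 1 * 1 : ℝ) * R ^ (l + 2 * s) := by gcongr
    _ = _ := by ring

theorem norm_dSum_le {h : ℝ} (h0 : 0 < h) (h1 : h < 1) {μ : ℂ} {R : ℝ} (hR : 1 ≤ R)
    (hμ : ‖μ‖ ≤ R) (s l : ℕ) : ‖dSum h μ s l‖ ≤ (2 * R ^ 2) ^ s * R ^ l := by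
  calc ‖dSum h μ s l‖ ≤ ∑ p ∈ Finset.range (s + 1), R ^ (l + 2 * s) := by
        refine (norm_sum_le _ _).trans (Finset.sum_le_sum fun p hp => ?_)
        rw [Int.toNat_natCast, Finset.mem_range] at hp
        exact norm_dTerm_le h0 h1 hR hμ (by omega)
    _ = (s + 1 : ℕ) * R ^ (l + 2 * s) := by simp
    _ ≤ 2 ^ s * R ^ (l + 2 * s) := by
        gcongr
        exact_mod_cast Nat.succ_le_of_lt Nat.lt_two_pow_self
    _ = _ := by ring

theorem exists_norm_tauSum_le {h : ℝ} (h0 : 0 < h) (h1 : h < 1) {μ : ℂ} {R : ℝ} (hR : 1 ≤ R)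
    (hμ : ‖μ‖ ≤ R) {c : ℤ} (hcR : h ^ (1 + 2 * c) ≤ R) : ∃ C : ℝ, 0 ≤ C ∧ ∀ (d κ : ℤ) (N : ℕ),
      c ≤ κ → d ≤ N → ‖tauSum h μ d κ‖ ≤ (R ^ 2) ^ N * C := by
  refine ⟨∑' e : ℕ, (R ^ 4) ^ e * (h ^ 2) ^ e ^ 2, tsum_nonneg fun e => by positivity,
    fun d κ N hc hN => ?_⟩
  rw [← tsum_mul_left]
  exact tsum_of_norm_bounded ((summable_pow_four_mul h0 h1 hR).mul_left _).hasSum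
    fun e => norm_tauTerm_le h0 h1 hR hμ hc hcR hN e

theorem summable_tauTerm {h : ℝ} (h0 : 0 < h) (h1 : h < 1) (μ : ℂ) (d κ : ℤ) :
    Summable (tauTerm h μ d κ) := by
  set R : ℝ := max 1 (max ‖μ‖ (h ^ (1 + 2 * κ)))
  have hR : 1 ≤ R := le_max_left _ _
  refine Summable.of_norm_bounded ((summable_pow_four_mul h0 h1 hR).mul_left ((R ^ 2) ^ d.toNat))
    fun e => norm_tauTerm_le h0 h1 hR ?_ le_rfl ?_ (by omega) e
  · exact (le_max_left _ _).trans (le_max_right _ _)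
  · exact (le_max_right _ _).trans (le_max_right _ _)

/-! ### The intertwining identity -/

/-- With `b = p + e + j`, the factors `1/(l-s+p)_q!` and `1/(e+j-l+s)_q!` have arguments adding up
to `b`. They are the `r` and `b - r` of the q-binomial expansion of `δ(z)^b`, so `lowerSum_vSum`
evaluates the sum. It matters that `κ = k + n + s` does not depend on `l`. -/
theorem sum_dTerm_mul_tauTerm {h : ℝ} (h0 : 0 < h) (h1 : h < 1) (μ : ℂ) (j k n : ℤ) {s p : ℕ}
    (hp : p ≤ s) (e : ℕ) :
    HasSum (fun l : ℕ => dTerm h μ s l p * tauTerm h μ (j - l + s) (k + n + s) e *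
        ((qFact (h ^ 4) l * vSum h k l n : ℝ) : ℂ))
      (μ ^ (2 * (p + e) + j).toNat * ((h ^ ((2 * (p + e) + j) ^ 2) * rfact (h ^ 4) (p + e + j) *
        (h ^ (2 * e * (k + n - (p + e + j) + s - p) + e * (e + 1) : ℤ) * (rfact (h ^ 4) p *
          rfact (h ^ 4) e * vSum h k (s - p) (n - (p + e + j)))) : ℝ) : ℂ)) := by
  have hq : 0 < h ^ 4 := by positivity
  have hq1 : h ^ 4 < 1 := pow_lt_one₀ h0.le h1 (by norm_num)
  rcases lt_or_ge ((p : ℤ) + e + j) 0 with hb | hb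
  · rw [rfact_of_neg _ hb]
    simp only [mul_zero, zero_mul, Complex.ofReal_zero]
    -- The two arguments have negative sum, so at least one of the reciprocal factorials vanishes in
    -- every term.
    convert hasSum_zero using 2 with l
    rcases lt_or_ge ((l : ℤ) - s + p) 0 with hl | hl
    · rw [dTerm, rfact_of_neg _ hl]; simp
    · rw [tauTerm, rfact_of_neg _ (show (e : ℤ) + (j - l + s) < 0 by omega)]; simp
  obtain ⟨b, hb⟩ := Int.eq_ofNat_of_zero_le hb
  obtain ⟨g, rfl⟩ := Nat.exists_eq_add_of_le hp
  have hj : j = b - p - e := by omega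
  subst hj
  have hL := lowerSum_vSum h0 h1 k n b (s := g) (by omega)
  rw [Int.toNat_natCast, lowerSum] at hL
  have hg := (qFact_pos hq hq1 g).ne'
  -- Here `s = p + g`, and the nonzero terms are among `l = g + r` with `0 ≤ r ≤ b`.
  have hsum : HasSum (fun l : ℕ => dTerm h μ (p + g : ℕ) l p *
      tauTerm h μ (b - p - e - l + (p + g : ℕ)) (k + n + (p + g : ℕ)) e *
        ((qFact (h ^ 4) l * vSum h k l n : ℝ) : ℂ))
      (∑ l ∈ (Finset.range (b + 1)).map (addLeftEmbedding g), dTerm h μ (p + g : ℕ) l p *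
      tauTerm h μ (b - p - e - l + (p + g : ℕ)) (k + n + (p + g : ℕ)) e *
        ((qFact (h ^ 4) l * vSum h k l n : ℝ) : ℂ)) := by
    refine hasSum_sum_of_ne_finset_zero fun l hl => ?_
    rcases lt_or_ge ((l : ℤ) - g) 0 with hl1 | hl1
    · rw [dTerm, rfact_of_neg _ (show (l : ℤ) - (p + g : ℕ) + p < 0 by push_cast; omega)]; simp
    · have : (b : ℤ) < l - g := by
        by_contra hcon
        refine hl (Finset.mem_map.2 ⟨l - g, ?_, ?_⟩)
        · rw [Finset.mem_range]; omega
        · simp only [addLeftEmbedding_apply]; omega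
      rw [tauTerm, rfact_of_neg _ (show (e : ℤ) + (b - p - e - l + (p + g : ℕ)) < 0 by
        push_cast; omega)]; simp
  convert hsum using 1
  rw [Finset.sum_map]
  simp only [addLeftEmbedding_apply]
  have hR : rfact (h ^ 4) b * vSum h k g (n - b) = rfact (h ^ 4) g *
      (qFact (h ^ 4) g * rfact (h ^ 4) b * vSum h k g (n - b)) := by
    rw [rfact_natCast _ g]; field_simp
  rw [show 2 * ((p : ℤ) + e) + (b - p - e) = p + e + b by ring,
    show (p : ℤ) + e + (b - p - e) = b by ring, show (((p + g : ℕ) : ℤ) - p) = g by push_cast; ring]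
  have hR' : h ^ (((p : ℤ) + e + b) ^ 2) * rfact (h ^ 4) b *
      (h ^ (2 * e * (k + n - b + (p + g : ℕ) - p) + e * (e + 1) : ℤ) *
        (rfact (h ^ 4) p * rfact (h ^ 4) e * vSum h k g (n - b))) =
      h ^ (((p : ℤ) + e + b) ^ 2) *
      h ^ (2 * e * (k + n - b + (p + g : ℕ) - p) + e * (e + 1) : ℤ) *
        (rfact (h ^ 4) p * rfact (h ^ 4) e) * (rfact (h ^ 4) b * vSum h k g (n - b)) := by ring
  rw [hR', hR, ← hL, Finset.mul_sum, Finset.mul_sum, Complex.ofReal_sum, Finset.mul_sum]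
  refine Finset.sum_congr rfl fun r hr => ?_
  rw [Finset.mem_range] at hr
  have m1 : μ ^ ((p : ℤ) + e + b).toNat = μ ^ (((g + r : ℕ) : ℤ) - (p + g : ℕ) + 2 * p).toNat *
      μ ^ (2 * (e : ℤ) + (b - p - e - (g + r : ℕ) + (p + g : ℕ))).toNat := by
    rw [← pow_add]
    congr 1
    push_cast
    omega
  have m2 : h ^ (((p : ℤ) + e + b) ^ 2) *
      h ^ (2 * e * (k + n - b + (p + g : ℕ) - p) + e * (e + 1) : ℤ) *
      h ^ (2 * (b - r) * (k + n + g - r) - (b - r) * (b - r - 1) : ℤ) =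
      h ^ ((((g + r : ℕ) : ℤ) - (p + g : ℕ) + 2 * p) ^ 2) * h ^ (2 * (e : ℤ) ^ 2 +
        (2 * e + (b - p - e - (g + r : ℕ) + (p + g : ℕ))) * (1 + 2 * (k + n + (p + g : ℕ)))) := by
    rw [← zpow_add₀ h0.ne', ← zpow_add₀ h0.ne', ← zpow_add₀ h0.ne']
    congr 1
    push_cast
    ring
  rw [dTerm, tauTerm, m1, show ((g + r : ℕ) : ℤ) - (p + g : ℕ) + p = r by push_cast; ring,
    show (e : ℤ) + (b - p - e - (g + r : ℕ) + (p + g : ℕ)) = b - r by push_cast; ring,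
    show (((p + g : ℕ) : ℤ) - p) = g by push_cast; ring, show ((g : ℤ) + r).toNat = g + r by omega,
    show ((g : ℤ) + r) = (g + r : ℕ) by push_cast; ring]
  have m3 : h ^ (((p : ℤ) + e + b) ^ 2) *
      h ^ (2 * e * (k + n - b + (p + g : ℕ) - p) + e * (e + 1) : ℤ) *
      (rfact (h ^ 4) p * rfact (h ^ 4) e) * (rfact (h ^ 4) g *
      (h ^ (2 * (b - r) * (k + n + g - r) - (b - r) * (b - r - 1) : ℤ) *
      (rfact (h ^ 4) r * rfact (h ^ 4) (b - r) *
        (qFact (h ^ 4) (g + r) * vSum h k (g + r : ℕ) n)))) =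
      (rfact (h ^ 4) p * rfact (h ^ 4) g * rfact (h ^ 4) r *
        h ^ ((((g + r : ℕ) : ℤ) - (p + g : ℕ) + 2 * p) ^ 2)) *
      (rfact (h ^ 4) e * rfact (h ^ 4) (b - r) * h ^ (2 * (e : ℤ) ^ 2 +
        (2 * e + (b - p - e - (g + r : ℕ) + (p + g : ℕ))) * (1 + 2 * (k + n + (p + g : ℕ))))) *
      (qFact (h ^ 4) (g + r) * vSum h k (g + r : ℕ) n) := by
    linear_combination (rfact (h ^ 4) p * rfact (h ^ 4) e * (rfact (h ^ 4) g *
      (rfact (h ^ 4) r * rfact (h ^ 4) (b - r) *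
        (qFact (h ^ 4) (g + r) * vSum h k (g + r : ℕ) n)))) * m2
  rw [m3]
  push_cast
  ring

theorem exists_growth_bound (h : ℝ) (μ : ℂ) (c : ℤ) :
    ∃ R : ℝ, 1 ≤ R ∧ ‖μ‖ ≤ R ∧ h ^ (1 + 2 * c) ≤ R :=
  ⟨max 1 (max ‖μ‖ (h ^ (1 + 2 * c))), le_max_left _ _,
    (le_max_left _ _).trans (le_max_right _ _), (le_max_right _ _).trans (le_max_right _ _)⟩

theorem norm_qFact_mul_vSum {h : ℝ} (h0 : 0 < h) (h1 : h < 1) (k : ℤ) (l n : ℕ) :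
    ‖((qFact (h ^ 4) l * vSum h k l n : ℝ) : ℂ)‖ = qFact (h ^ 4) l * |vSum h k l n| := by
  rw [Complex.norm_real, Real.norm_eq_abs, abs_mul,
    abs_of_pos (qFact_pos (by positivity) (pow_lt_one₀ h0.le h1 (by norm_num)) l)]

theorem summable_dTerm_mul_tauTerm {h : ℝ} (h0 : 0 < h) (h1 : h < 1) (μ : ℂ) (j k : ℤ) (n : ℕ)
    {s p : ℕ} (hp : p ≤ s) :
    Summable fun x : ℕ × ℕ => dTerm h μ s x.2 p * tauTerm h μ (j - x.2 + s) (k + n + s) x.1 *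
        ((qFact (h ^ 4) x.2 * vSum h k x.2 n : ℝ) : ℂ) := by
  obtain ⟨R, hR, hμ, hcR⟩ := exists_growth_bound h μ (k + n + s)
  have hR0 : 0 < R := by linarith
  have B := (Summable.mul_of_nonneg (summable_pow_four_mul h0 h1 hR)
    (summable_pow_mul_qFact_mul_vSum h0 h1 k n hR0) (fun e => by positivity) (fun l => by
      have := (qFact_pos (q := h ^ 4) (by positivity) (pow_lt_one₀ h0.le h1 (by norm_num)) l).le
      positivity)).mul_left (R ^ (2 * s) * (R ^ 2) ^ (j.natAbs + s))
  refine Summable.of_norm_bounded B fun x => ?_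
  have b1 := norm_dTerm_le h0 h1 hR hμ (l := x.2) hp
  have b2 := norm_tauTerm_le h0 h1 hR hμ (le_refl (k + n + s)) hcR (d := j - x.2 + s)
    (N := j.natAbs + s) (by omega) x.1
  rw [norm_mul, norm_mul, norm_qFact_mul_vSum h0 h1]
  have hw : 0 ≤ qFact (h ^ 4) x.2 * |vSum h k x.2 n| := by
    rw [← norm_qFact_mul_vSum h0 h1]; exact norm_nonneg _
  calc _ ≤ R ^ (x.2 + 2 * s) * ((R ^ 2) ^ (j.natAbs + s) * ((R ^ 4) ^ x.1 * (h ^ 2) ^ x.1 ^ 2)) *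
        (qFact (h ^ 4) x.2 * |vSum h k x.2 n|) := by gcongr
    _ = _ := by ring

theorem hasSum_of_prod_fiberwise_right {F : ℕ → ℕ → ℂ} {S : ℂ} {f : ℕ → ℂ}
    (hF : HasSum (fun x : ℕ × ℕ => F x.1 x.2) S) (hf : ∀ l, HasSum (fun e => F e l) (f l)) :
    HasSum f S :=
  HasSum.prod_fiberwise (f := fun x : ℕ × ℕ => F x.2 x.1) ((Equiv.prodComm ℕ ℕ).hasSum_iff.2 hF) hf

/-- The coefficients `∑_i D_i ⊗ t_{ji}` act on the transformed basis as `D_j` on the original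
one. -/
theorem hasSum_dSum_mul_tauSum {h : ℝ} (h0 : 0 < h) (h1 : h < 1) (μ : ℂ) (j k : ℤ) (s n : ℕ) :
    HasSum (fun l : ℕ => dSum h μ s l * tauSum h μ (j - l + s) (k + n + s) *
        ((qFact (h ^ 4) l * vSum h k l n : ℝ) : ℂ))
      (dSum h μ (n - j) n * ((qFact (h ^ 4) (n - j).toNat * vSum h k s (n - j) : ℝ) : ℂ)) := by
  -- `H p a` is the sum over `l` already evaluated, with `a = p + e` the total power of `δ(z*)`.
  set H : ℕ → ℕ → ℂ := fun p a => μ ^ (2 * a + j).toNat *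
    ((h ^ ((2 * a + j) ^ 2) * rfact (h ^ 4) (a + j) *
        (h ^ (2 * (a - p) * (k + n - (a + j) + s - p) + (a - p) * (a - p + 1) : ℤ) *
        (rfact (h ^ 4) p * rfact (h ^ 4) (a - p) * vSum h k (s - p) (n - (a + j)))) : ℝ) : ℂ)
    with hH
  have step : ∀ p ∈ Finset.range (s + 1), ∃ S, HasSum (fun l : ℕ => dTerm h μ s l p *
      tauSum h μ (j - l + s) (k + n + s) * ((qFact (h ^ 4) l * vSum h k l n : ℝ) : ℂ)) S ∧
      HasSum (H p) S := by
    intro p hp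
    have hp' : p ≤ s := by rw [Finset.mem_range] at hp; omega
    obtain ⟨S, hF⟩ := summable_dTerm_mul_tauTerm h0 h1 μ j k n hp'
    refine ⟨S, ?_, ?_⟩
    rotate_left
    · have h3 := hF.prod_fiberwise fun e => sum_dTerm_mul_tauTerm h0 h1 μ j k n hp' e
      -- Passing from `e` to `a = p + e` only adds indices `a < p`, where `1/(a-p)_q!` is zero.
      refine ((add_right_injective p).hasSum_iff fun a ha => ?_).1 (?_ : HasSum (H p ∘ _) _)
      · have : (a : ℤ) - p < 0 := by
          by_contra hcon
          exact ha ⟨a - p, by simp only []; omega⟩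
        simp only [hH]
        rw [rfact_of_neg _ this]
        simp
      · convert h3 using 2 with e
        simp only [hH, Function.comp]
        push_cast
        rw [show (p : ℤ) + e - p = e by ring]
    · exact hasSum_of_prod_fiberwise_right (F := fun e l => dTerm h μ s l p *
        tauTerm h μ (j - l + s) (k + n + s) e * ((qFact (h ^ 4) l * vSum h k l n : ℝ) : ℂ)) hF
        fun l => ((summable_tauTerm h0 h1 μ _ _).hasSum.mul_left _).mul_right _
  choose! S hS1 hS2 using step
  have t1 := hasSum_sum hS1
  have t2 := hasSum_sum hS2
  have t3 : HasSum (fun a : ℕ => ∑ p ∈ Finset.range (s + 1), H p a)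
      (dSum h μ (n - j) n *
        ((qFact (h ^ 4) (n - j).toNat * vSum h k s (n - j) : ℝ) : ℂ)) := by
    have hz : ∀ a : ℕ, (n : ℤ) - j - a < 0 → dTerm h μ (n - j) n a = 0 := fun a ha => by
      rw [dTerm, rfact_of_neg _ ha]; simp
    have t4 : HasSum (fun a : ℕ => dTerm h μ (n - j) n a) (dSum h μ (n - j) n) := by
      refine hasSum_sum_of_ne_finset_zero fun a ha => hz a ?_
      rw [Finset.mem_range] at ha
      omega
    suffices t5 : (fun a : ℕ => ∑ p ∈ Finset.range (s + 1), H p a) = fun a : ℕ =>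
        dTerm h μ (n - j) n a *
          ((qFact (h ^ 4) (n - j).toNat * vSum h k s (n - j) : ℝ) : ℂ)  by
      rw [t5]
      exact t4.mul_right _
    funext a
    rcases lt_or_ge ((n : ℤ) - (a + j)) 0 with hn | hn
    · rw [hz a (by omega), zero_mul]
      refine Finset.sum_eq_zero fun p _ => ?_
      simp only [hH]
      rw [vSum_of_neg_right _ _ _ hn]
      simp
    · have hr := raiseSum_vSum h0 h1 k hn a s
      rw [show (n : ℤ) - (a + j) + a = n - j by ring] at hr
      -- The ranges `p ≤ a` and `p ≤ s` may both be enlarged to `p ≤ s + a`: terms with `p > a`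
      -- vanish by `1/(a-p)_q!`, terms with `p > s` because the row `s - p` is negative.
      have hr2 : raiseSum h (k + (n - (a + j))) (fun z => vSum h k z (n - (a + j))) a s =
          ∑ p ∈ Finset.range (s + 1),
          h ^ (2 * (a - p) * (k + n - (a + j) + s - p) + (a - p) * (a - p + 1) : ℤ) *
        (rfact (h ^ 4) p * rfact (h ^ 4) (a - p) * vSum h k (s - p) (n - (a + j))) := by
        rw [raiseSum, ← add_sub_assoc]
        trans ∑ p ∈ Finset.range (s + a + 1),
          h ^ (2 * (a - p) * (k + n - (a + j) + s - p) + (a - p) * (a - p + 1) : ℤ) *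
          (rfact (h ^ 4) p * rfact (h ^ 4) (a - p) * vSum h k (s - p) (n - (a + j)))
        · refine Finset.sum_subset (fun p hp => ?_) fun p _ hp => ?_
          · simp only [Finset.mem_range] at hp ⊢; omega
          · simp only [Finset.mem_range] at hp
            rw [rfact_of_neg _ (show (a : ℤ) - p < 0 by omega)]
            ring
        · refine (Finset.sum_subset (fun p hp => ?_) fun p _ hp => ?_).symm
          · simp only [Finset.mem_range] at hp ⊢; omega
          · simp only [Finset.mem_range] at hp
            rw [vSum_of_neg_left _ _ _ (show (s : ℤ) - p < 0 by omega)]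
            ring
      simp only [hH]
      rw [← Finset.mul_sum, ← Complex.ofReal_sum, ← Finset.mul_sum, ← hr2, hr, dTerm,
        show (n : ℤ) - (n - j) + a = a + j by ring, show (n : ℤ) - j - a = n - (a + j) by ring,
        show (n : ℤ) - (n - j) + 2 * a = 2 * a + j by ring]
      push_cast
      ring
  rw [← t2.unique t3]
  convert t1 using 2 with l
  rw [dSum, Finset.sum_mul, Finset.sum_mul, Int.toNat_natCast]

/-! ### Euler's sum -/

/-- Euler's sum `∑_s q^(s(s-1)/2) x^s / (s)_q!`. -/
def eulerSum (q x : ℝ) : ℝ := ∑' s : ℕ, q ^ s.choose 2 * x ^ s / qFact q s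

theorem summable_eulerSum {h : ℝ} (h0 : 0 < h) (h1 : h < 1) {x : ℝ} (hx : 0 < x) :
    Summable fun s : ℕ => (h ^ 4) ^ s.choose 2 * x ^ s / qFact (h ^ 4) s := by
  have hq : 0 < h ^ 4 := by positivity
  have hq1 : h ^ 4 < 1 := pow_lt_one₀ h0.le h1 (by norm_num)
  refine Summable.of_nonneg_of_le (fun s => ?_) (fun s => ?_)
    (summable_pow_mul_pow_sq (h := h ^ 2) (by positivity) (pow_lt_one₀ h0.le h1 (by norm_num))
      (R := x / h ^ 2) (by positivity))
  · have := qFact_pos hq hq1 s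
    positivity
  · have e : (h ^ 4) ^ s.choose 2 * x ^ s = (x / h ^ 2) ^ s * (h ^ 2) ^ s ^ 2 := by
      have h2 := two_mul_choose_two_add s
      rw [← h2, pow_add, pow_mul (h ^ 2) 2, ← pow_mul h 2 2, div_pow]
      field_simp
    rw [e]
    exact div_le_self (by positivity) (one_le_qFact hq hq1 s)

/-- Coefficientwise, `(1 - q^(s+1)) / (s+1)_q! = (1 - q) / (s)_q!`. -/
theorem eulerSum_step {h : ℝ} (h0 : 0 < h) (h1 : h < 1) {x : ℝ} (hx : 0 < x) :
    eulerSum (h ^ 4) x = (1 + (1 - h ^ 4) * x) * eulerSum (h ^ 4) (h ^ 4 * x) := by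
  have hq : 0 < h ^ 4 := by positivity
  have hq1 : h ^ 4 < 1 := pow_lt_one₀ h0.le h1 (by norm_num)
  have s1 := summable_eulerSum h0 h1 hx
  have s2 := summable_eulerSum h0 h1 (x := h ^ 4 * x) (by positivity)
  have e : eulerSum (h ^ 4) x - eulerSum (h ^ 4) (h ^ 4 * x) =
      (1 - h ^ 4) * x * eulerSum (h ^ 4) (h ^ 4 * x) := by
    rw [eulerSum, eulerSum, ← s1.tsum_sub s2, (s1.sub s2).tsum_eq_zero_add, ← tsum_mul_left]
    simp only [pow_zero, sub_self, zero_add]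
    refine tsum_congr fun k => ?_
    have hk := (qFact_pos hq hq1 k).ne'
    have h2 : (1 : ℝ) - (h ^ 4) ^ (k + 1) ≠ 0 :=
      (sub_pos.2 (pow_lt_one₀ hq.le hq1 (Nat.succ_ne_zero k))).ne'
    have h3 : (1 : ℝ) - h ^ 4 ≠ 0 := (sub_pos.2 hq1).ne'
    rw [qFact_succ, qNum, mul_pow, mul_pow, Nat.choose_succ_succ' k 1, Nat.choose_one_right, pow_add]
    generalize h ^ 4 = q at *
    field_simp
    ring
  linear_combination e

theorem eulerSum_pos {h : ℝ} (h0 : 0 < h) (h1 : h < 1) {x : ℝ} (hx : 0 < x) :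
    0 < eulerSum (h ^ 4) x := by
  have hq : 0 < h ^ 4 := by positivity
  have hq1 : h ^ 4 < 1 := pow_lt_one₀ h0.le h1 (by norm_num)
  refine (summable_eulerSum h0 h1 hx).tsum_pos (fun s => ?_) 0 ?_
  · have := qFact_pos hq hq1 s
    positivity
  · simp [qFact_zero]

/-- Iterating `eulerSum_step` splits off the partial products of `∏ (1 + (1-q) q^i x)`, and the
remaining factor `eulerSum q (q^n x)` tends to `1`. This works for all `x > 0`, beyond the disc
where the series of `e_q` converges. -/
theorem qExp_neg_eq {h : ℝ} (h0 : 0 < h) (h1 : h < 1) {x : ℝ} (hx : 0 < x) :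
    qExp (h ^ 4) (-x) = (eulerSum (h ^ 4) x)⁻¹ := by
  have hq : 0 < h ^ 4 := by positivity
  have hq1 : h ^ 4 < 1 := pow_lt_one₀ h0.le h1 (by norm_num)
  set q := h ^ 4 with hqdef
  have hprod : ∀ n : ℕ, (∏ i ∈ Finset.range n, (1 - (1 - q) * q ^ i * -x)) *
      eulerSum q (q ^ n * x) = eulerSum q x := by
    intro n
    induction n with
    | zero => simp
    | succ n ih =>
      have := eulerSum_step h0 h1 (x := q ^ n * x) (by positivity)
      rw [← hqdef, show q * (q ^ n * x) = q ^ (n + 1) * x by ring] at this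
      rw [← ih, Finset.prod_range_succ, this]
      ring
  have hm : Multipliable fun i : ℕ => 1 - (1 - q) * q ^ i * -x := by
    have : Summable fun i : ℕ => ‖-((1 - q) * q ^ i * -x)‖ := by
      refine Summable.norm (Summable.neg (Summable.mul_right _ (Summable.mul_left _ ?_)))
      exact summable_geometric_of_lt_one hq.le hq1
    simpa [sub_eq_add_neg] using multipliable_one_add_of_summable this
  have hl2 : Filter.Tendsto (fun n : ℕ => eulerSum q (q ^ n * x)) Filter.atTop (nhds 1) := by
    have h0' : (∑' s : ℕ, q ^ s.choose 2 * (0 : ℝ) ^ s / qFact q s) = 1 := by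
      rw [tsum_eq_single 0]
      · simp [qFact_zero]
      · intro k hk; simp [hk]
    rw [← h0']
    refine tendsto_tsum_of_dominated_convergence (summable_eulerSum h0 h1 hx) (fun k => ?_)
      (Filter.Eventually.of_forall fun n k => ?_)
    · have : Filter.Tendsto (fun n : ℕ => q ^ n * x) Filter.atTop (nhds 0) := by
        simpa using (tendsto_pow_atTop_nhds_zero_of_lt_one hq.le hq1).mul_const x
      exact ((this.pow k).const_mul _).div_const _
    · have := qFact_pos hq hq1 k
      rw [Real.norm_of_nonneg (by positivity)]
      gcongr
      exact mul_le_of_le_one_left hx.le (pow_le_one₀ hq.le hq1.le)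
  have hl1 := (hm.hasProd.tendsto_prod_nat).mul hl2
  simp only [hprod, mul_one] at hl1
  rw [qExp, tendsto_nhds_unique hl1 tendsto_const_nhds]

theorem qExp_neg_pos {h : ℝ} (h0 : 0 < h) (h1 : h < 1) {x : ℝ} (hx : 0 < x) :
    0 < qExp (h ^ 4) (-x) := by
  rw [qExp_neg_eq h0 h1 hx]
  exact inv_pos.2 (eulerSum_pos h0 h1 hx)

/-! ### Orthogonality -/

theorem summable_pairing {h : ℝ} (h0 : 0 < h) (h1 : h < 1) (k k' : ℤ) (m n : ℕ) {R : ℝ}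
    (hR : 0 < R) :
    Summable fun s : ℕ => R ^ s * (qFact (h ^ 4) s * (vSum h k s m * vSum h k' s n)) := by
  have hw : ∀ s : ℕ, 0 < qFact (h ^ 4) s :=
    qFact_pos (by positivity) (pow_lt_one₀ h0.le h1 (by norm_num))
  have a := Summable.mul_of_nonneg (summable_pow_mul_qFact_mul_vSum h0 h1 k m hR)
    (summable_pow_mul_vSum h0 h1 k' n zero_lt_one) (fun s => by have := hw s; positivity)
    (fun s => by positivity)
  have b := a.comp_injective (i := fun s : ℕ => (s, s)) fun s t hst => (Prod.mk.inj hst).1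
  refine Summable.of_norm_bounded b fun s => le_of_eq ?_
  have := hw s
  rw [Real.norm_eq_abs, abs_mul, abs_mul, abs_mul, abs_of_pos (show 0 < R ^ s by positivity),
    abs_of_pos this]
  simp only [Function.comp]
  ring

/-- The scalar product of the `n`-th and the `m`-th columns in the sector `c`. -/
def pairing (h : ℝ) (c m n : ℤ) : ℝ :=
  ∑' s : ℕ, qFact (h ^ 4) s * (vSum h (c - m) s m * vSum h (c - n) s n)

theorem pairing_comm (h : ℝ) (c m n : ℤ) : pairing h c m n = pairing h c n m :=
  tsum_congr fun s => by rw [mul_comm (vSum h (c - m) s m)]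

/-- `δ(z*)` on one factor is moved to the other as its adjoint `δ(z)`: expand the column `n + 1` by
`vSum_succ_right`, shift `s` in the second part, and recombine by `vSum_pred_right` in the column
`m`. For `m = 0` the result involves the column `-1`, which is zero. -/
theorem pairing_succ {h : ℝ} (h0 : 0 < h) (h1 : h < 1) (c : ℤ) (m n : ℕ) :
    qInt (h ^ 4) (n + 1) * pairing h (c + 1) m (n + 1) = pairing h c (m - 1) n := by
  set a : ℕ → ℝ := fun s => h ^ (2 * (c + s + 1)) *
    (qFact (h ^ 4) s * (vSum h (c + 1 - m) s m * vSum h (c - n) s n)) with ha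
  set b : ℕ → ℝ := fun s =>
    qFact (h ^ 4) s * (vSum h (c + 1 - m) s m * vSum h (c - n) (s - 1) n) with hb
  have hab : ∀ s : ℕ, qInt (h ^ 4) (n + 1) * (qFact (h ^ 4) s * (vSum h (c + 1 - m) s m *
      vSum h (c + 1 - (n + 1)) s (n + 1))) = a s + b s := by
    intro s
    have := vSum_succ_right h0 h1 (c - n) s n
    rw [sub_add_cancel] at this
    rw [add_sub_add_right_eq_sub]
    simp only [ha, hb]
    linear_combination (qFact (h ^ 4) s * vSum h (c + 1 - m) s m) * this
  have sa : Summable a := by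
    refine ((summable_pairing h0 h1 (c + 1 - m) (c - n) m n (R := h ^ 2) (by positivity)).mul_left
      (h ^ (2 * (c + 1)))).congr fun s => ?_
    simp only [ha]
    rw [← mul_assoc, ← pow_mul, ← zpow_natCast, ← zpow_add₀ h0.ne']
    congr 2
    push_cast
    ring
  have sab : Summable fun s => a s + b s := by
    have := ((summable_pairing h0 h1 (c + 1 - m) (c + 1 - (n + 1)) m (n + 1)
      zero_lt_one).mul_left (qInt (h ^ 4) (n + 1)))
    refine this.congr fun s => ?_
    rw [← hab, one_pow, one_mul]
    push_cast
    rfl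
  have sb : Summable b := by
    refine (sab.sub sa).congr fun s => by ring
  have b0 : b 0 = 0 := by
    simp only [hb]
    rw [vSum_of_neg_left _ (c - n) _ (show ((0 : ℕ) : ℤ) - 1 < 0 by simp)]
    ring
  rw [pairing, pairing, ← tsum_mul_left]
  simp only [hab]
  rw [sa.tsum_add sb, sb.tsum_eq_zero_add, b0, zero_add,
    ← sa.tsum_add ((summable_nat_add_iff 1).2 sb)]
  refine tsum_congr fun s => ?_
  have := vSum_pred_right h0 h1 (c + 1 - m) s m
  rw [show c + 1 - (m : ℤ) + m + s = c + s + 1 by ring] at this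
  simp only [ha, hb]
  rw [qFact_succ, ← qInt_natCast, show c - ((m : ℤ) - 1) = c + 1 - m by ring, ← this]
  push_cast
  rw [add_sub_cancel_right]
  ring

theorem pairing_zero_zero {h : ℝ} (h0 : 0 < h) (h1 : h < 1) (c : ℤ) :
    pairing h c 0 0 = (qExp (h ^ 4) (-(h ^ 4) ^ c))⁻¹ := by
  have hx : 0 < (h ^ 4) ^ c := by positivity
  rw [qExp_neg_eq h0 h1 hx, inv_inv, pairing, eulerSum]
  refine tsum_congr fun s => ?_
  have hs := (qFact_pos (q := h ^ 4) (by positivity) (pow_lt_one₀ h0.le h1 (by norm_num)) s).ne'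
  have e : h ^ ((s : ℤ) ^ 2 - s + 2 * c * s) * h ^ ((s : ℤ) ^ 2 - s + 2 * c * s) =
      (h ^ 4) ^ s.choose 2 * ((h ^ 4) ^ c) ^ s := by
    have h2 := two_mul_choose_two_cast s
    rw [← pow_mul, ← zpow_natCast, ← zpow_natCast ((h ^ 4) ^ c), ← zpow_mul, pow_four_zpow,
      ← zpow_add₀ h0.ne', ← zpow_add₀ h0.ne']
    congr 1
    push_cast
    linear_combination (-2) * h2
  have e1 : ((-1 : ℝ) ^ (s : ℤ)) * (-1) ^ (s : ℤ) = 1 := by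
    rw [← mul_zpow]; simp
  rw [sub_zero, vSum_zero_right, rfact_natCast, ← e]
  field_simp
  rw [zpow_natCast] at *
  linear_combination e1

/-- Lowering both indices together reaches either the ground state paired with itself, evaluated by
Euler's sum, or the ground state paired with a raised vector, which is zero. -/
theorem pairing_eq {h : ℝ} (h0 : 0 < h) (h1 : h < 1) (c : ℤ) (m n : ℕ) :
    pairing h c m n =
      if m = n then (qFact (h ^ 4) n * qExp (h ^ 4) (-(h ^ 4) ^ (c - n)))⁻¹ else 0 := by
  have hq : 0 < h ^ 4 := by positivity
  have hq1 : h ^ 4 < 1 := pow_lt_one₀ h0.le h1 (by norm_num)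
  have hz : ∀ (c : ℤ) (n : ℕ), pairing h c ((0 : ℕ) : ℤ) (n + 1 : ℕ) = 0 := by
    intro c n
    refine mul_left_cancel₀ (qInt_succ_ne_zero hq hq1 n) ?_
    have := pairing_succ h0 h1 (c - 1) 0 n
    rw [sub_add_cancel] at this
    rw [Nat.cast_succ, this, mul_zero, pairing]
    simp [vSum_of_neg_right]
  induction n generalizing m c with
  | zero =>
    rcases m with _ | m
    · simp [pairing_zero_zero h0 h1, qFact_zero]
    · rw [pairing_comm, hz]
      simp
  | succ n ih =>
    rcases m with _ | m
    · rw [hz]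
      simp
    · have h2 := qInt_succ_ne_zero hq hq1 n
      refine mul_left_cancel₀ h2 ?_
      have := pairing_succ h0 h1 (c - 1) (m + 1) n
      rw [sub_add_cancel, Nat.cast_succ m, add_sub_cancel_right] at this
      rw [Nat.cast_succ, Nat.cast_succ, this, ih, qFact_succ, ← qInt_natCast]
      simp only [add_left_inj]
      split_ifs
      · push_cast
        rw [show c - 1 - (n : ℤ) = c - (n + 1) by ring]
        field_simp
      · simp

/-! ### The double series -/

/-- `dSum` and `tauSum` grow at most geometrically in `s` and `l`, while both columns of `vSum`
decay faster than any geometric sequence. The ratio `2 * R ^ 4` collects `2 * R ^ 2` from `dSum` and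
`R ^ 2` from `tauSum`. -/
theorem summable_double {h : ℝ} (h0 : 0 < h) (h1 : h < 1) (μ : ℂ) (j k k' : ℤ) (m n : ℕ) :
    Summable fun x : ℕ × ℕ => dSum h μ x.1 x.2 * tauSum h μ (j - x.2 + x.1) (k + n + x.1) *
      ((qFact (h ^ 4) x.2 * vSum h k x.2 n : ℝ) : ℂ) *
      ((qFact (h ^ 4) x.1 * vSum h k' x.1 m : ℝ) : ℂ) := by
  obtain ⟨R, hR, hμ, hcR⟩ := exists_growth_bound h μ (k + n)
  have hR0 : 0 < R := by linarith
  obtain ⟨C, hC, hτ⟩ := exists_norm_tauSum_le h0 h1 hR hμ hcR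
  have hw : ∀ s : ℕ, 0 < qFact (h ^ 4) s :=
    qFact_pos (by positivity) (pow_lt_one₀ h0.le h1 (by norm_num))
  have B := (Summable.mul_of_nonneg
    (summable_pow_mul_qFact_mul_vSum h0 h1 k' m (R := 2 * R ^ 4) (by positivity))
    (summable_pow_mul_qFact_mul_vSum h0 h1 k n hR0)
    (fun s => by have := (hw s).le; positivity)
    (fun l => by have := (hw l).le; positivity)).mul_left ((R ^ 2) ^ j.natAbs * C)
  refine Summable.of_norm_bounded B fun x => ?_
  have b1 := norm_dSum_le h0 h1 hR hμ x.1 x.2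
  have b2 := hτ (j - x.2 + x.1) (k + n + x.1) (j.natAbs + x.1) (by omega) (by omega)
  have w1 := (hw x.1).le
  have w2 := (hw x.2).le
  rw [norm_mul, norm_mul, norm_mul, norm_qFact_mul_vSum h0 h1, norm_qFact_mul_vSum h0 h1]
  calc _ ≤ ((2 * R ^ 2) ^ x.1 * R ^ x.2) * ((R ^ 2) ^ (j.natAbs + x.1) * C) *
        (qFact (h ^ 4) x.2 * |vSum h k x.2 n|) * (qFact (h ^ 4) x.1 * |vSum h k' x.1 m|) := by
        gcongr
    _ = _ := by ring

/-- Absolute convergence allows summing over `l` first, which turns the column `n` into a multiple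
of the column `n - j`. The sum over `s` is then a scalar product with the column `m`, nonzero only
if `m = n - j`. -/
theorem hasSum_double {h : ℝ} (h0 : 0 < h) (h1 : h < 1) (μ : ℂ) (j k : ℤ) (m n : ℕ) :
    HasSum (fun x : ℕ × ℕ => dSum h μ x.1 x.2 * tauSum h μ (j - x.2 + x.1) (k + n + x.1) *
      ((qFact (h ^ 4) x.2 * vSum h k x.2 n : ℝ) : ℂ) *
      ((qFact (h ^ 4) x.1 * vSum h (k + n - j - m) x.1 m : ℝ) : ℂ))
      (if j = n - m then dSum h μ m n * (((qExp (h ^ 4) (-(h ^ 4) ^ k))⁻¹ : ℝ) : ℂ) else 0) := by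
  obtain ⟨S, hS⟩ := summable_double h0 h1 μ j k (k + n - j - m) m n
  have hfib := hS.prod_fiberwise fun s : ℕ => (hasSum_dSum_mul_tauSum h0 h1 μ j k s n).mul_right
    (((qFact (h ^ 4) s * vSum h (k + n - j - m) s m : ℝ) : ℂ))
  convert hS using 1
  refine HasSum.unique ?_ hfib
  rcases lt_or_ge ((n : ℤ) - j) 0 with hn | hn
  · rw [if_neg (by omega)]
    simp only [vSum_of_neg_right h k _ hn, mul_zero, Complex.ofReal_zero, zero_mul]
    exact hasSum_zero
  obtain ⟨n', hn'⟩ := Int.eq_ofNat_of_zero_le hn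
  have e1 : k + n - j - m = k + n' - m := by omega
  have hp : HasSum (fun s : ℕ => qFact (h ^ 4) s * (vSum h (k + n' - m) s m *
      vSum h (k + n' - n') s n')) (pairing h (k + n') m n') := by
    have := summable_pairing h0 h1 (k + n' - m) (k + n' - n') m n' zero_lt_one
    simp only [one_pow, one_mul] at this
    exact this.hasSum
  rw [pairing_eq h0 h1, add_sub_cancel_right] at hp
  have hp2 := (Complex.hasSum_ofReal.2 hp).mul_left (dSum h μ n' n * (qFact (h ^ 4) n' : ℂ))
  rw [hn', e1]
  have hval : (if j = n - m then dSum h μ m n * (((qExp (h ^ 4) (-(h ^ 4) ^ k))⁻¹ : ℝ) : ℂ) else 0) =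
      dSum h μ n' n * (qFact (h ^ 4) n' : ℂ) *
        ((if m = n' then (qFact (h ^ 4) n' * qExp (h ^ 4) (-(h ^ 4) ^ k))⁻¹ else 0 : ℝ) : ℂ) := by
    by_cases hm : m = n'
    · subst hm
      have := (qFact_pos (q := h ^ 4) (by positivity) (pow_lt_one₀ h0.le h1 (by norm_num)) m).ne'
      have h3 : (qFact (h ^ 4) m : ℂ) ≠ 0 := by exact_mod_cast this
      rw [if_pos (by omega), if_pos rfl, mul_inv]
      push_cast
      field_simp
    · rw [if_neg (by omega), if_neg hm]
      simp
  rw [hval]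
  refine (congrArg (fun f : ℕ → ℂ => HasSum f _) (funext fun s => ?_)).mpr hp2
  rw [Int.toNat_natCast]
  push_cast
  ring

/-! ### Actions of the operators on basis vectors -/

theorem rpow_eq_zpow {h : ℝ} (h0 : 0 < h) {x : ℝ} {z : ℤ} (hx : 4 * x = z) :
    (h ^ 4) ^ x = h ^ z := by
  rw [← Real.rpow_natCast, ← Real.rpow_mul h0.le, ← Real.rpow_intCast, ← hx]
  norm_num

theorem opAPow_single (i k : ℤ) (a : ℂ) :
    opAPow i (Finsupp.single k a) = Finsupp.single (k - 2 * i) a := by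
  simp [opAPow, Finsupp.linearCombination_single]

theorem etaFun_single (q : ℝ) (F : ℝ → ℝ) (k : ℤ) (a : ℂ) :
    etaFun q F (Finsupp.single k a) = Finsupp.single k (((F (q ^ k) : ℝ) : ℂ) * a) := by
  simp [etaFun, Finsupp.linearCombination_single, mul_comm]

theorem opB_single {h : ℝ} (h0 : 0 < h) (k : ℤ) (a : ℂ) :
    opB (h ^ 4) (Finsupp.single k a) = Finsupp.single (k - 1) (((h ^ (2 * k) : ℝ) : ℂ) * a) := by
  rw [opB, Finsupp.linearCombination_single,
    rpow_eq_zpow h0 (z := 2 * k) (by push_cast; ring), Finsupp.smul_single, smul_eq_mul, mul_comm]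

theorem opBStar_single {h : ℝ} (h0 : 0 < h) (k : ℤ) (a : ℂ) :
    opBStar (h ^ 4) (Finsupp.single k a) =
      Finsupp.single (k + 1) (((h ^ (2 * (k + 1)) : ℝ) : ℂ) * a) := by
  rw [opBStar, Finsupp.linearCombination_single,
    rpow_eq_zpow h0 (z := 2 * (k + 1)) (by push_cast; ring), Finsupp.smul_single, smul_eq_mul,
    mul_comm]

theorem smul_opB_pow_single {h : ℝ} (h0 : 0 < h) (c : ℂ) (r : ℕ) (k : ℤ) (a : ℂ) :
    ((c • opB (h ^ 4)) ^ r) (Finsupp.single k a) =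
      Finsupp.single (k - r) (c ^ r * ((h ^ (2 * r * k - r * (r - 1)) : ℝ) : ℂ) * a) := by
  induction r with
  | zero => simp
  | succ r ih =>
    rw [pow_succ', Module.End.mul_apply, ih, LinearMap.smul_apply, opB_single h0,
      Finsupp.smul_single, smul_eq_mul]
    congr 1
    · push_cast; ring
    · have : h ^ (2 * ((r + 1 : ℕ) : ℤ) * k - (r + 1 : ℕ) * ((r + 1 : ℕ) - 1)) =
          h ^ (2 * (k - r)) * h ^ (2 * (r : ℤ) * k - r * (r - 1)) := by
        rw [← zpow_add₀ h0.ne']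
        congr 1
        push_cast
        ring
      rw [this]
      push_cast
      ring

theorem smul_opBStar_pow_single {h : ℝ} (h0 : 0 < h) (c : ℂ) (r : ℕ) (k : ℤ) (a : ℂ) :
    ((c • opBStar (h ^ 4)) ^ r) (Finsupp.single k a) =
      Finsupp.single (k + r) (c ^ r * ((h ^ (2 * r * k + r * (r + 1)) : ℝ) : ℂ) * a) := by
  induction r with
  | zero => simp
  | succ r ih =>
    rw [pow_succ', Module.End.mul_apply, ih, LinearMap.smul_apply, opBStar_single h0,
      Finsupp.smul_single, smul_eq_mul]
    congr 1
    · push_cast; ring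
    · have : h ^ (2 * ((r + 1 : ℕ) : ℤ) * k + (r + 1 : ℕ) * ((r + 1 : ℕ) + 1)) =
          h ^ (2 * (k + r + 1)) * h ^ (2 * (r : ℤ) * k + r * (r + 1)) := by
        rw [← zpow_add₀ h0.ne']
        congr 1
        push_cast
        ring
      rw [this]
      push_cast
      ring

/-! ### q-shifted factorials -/

theorem qPoch_succ (a q : ℝ) (k : ℕ) : qPoch a q (k + 1) = qPoch a q k * (1 - a * q ^ k) :=
  Finset.prod_range_succ _ _

theorem qPoch_pow_succ {q : ℝ} (hq1 : q < 1) (r k : ℕ) :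
    qFact q r * qPoch (q ^ (r + 1)) q k = (1 - q) ^ k * qFact q (r + k) := by
  have : (1 : ℝ) - q ≠ 0 := (sub_pos.2 hq1).ne'
  induction k with
  | zero => simp [qPoch]
  | succ k ih =>
    rw [qPoch_succ, ← mul_assoc, ih, ← add_assoc, qFact_succ, qNum, pow_succ]
    field_simp
    ring

theorem qPoch_self {q : ℝ} (hq1 : q < 1) (k : ℕ) : qPoch q q k = (1 - q) ^ k * qFact q k := by
  have := qPoch_pow_succ hq1 0 k
  simpa [qFact_zero] using this

theorem qPoch_zero_left (q : ℝ) (k : ℕ) : qPoch 0 q k = 1 := by simp [qPoch]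

theorem qPoch_inv_pow {q : ℝ} (hq : 0 < q) (hq1 : q < 1) (m k : ℕ) :
    q ^ k.choose 2 * qPoch (q ^ (-(m : ℤ))) q k = (-1) ^ k * q ^ ((k : ℤ) ^ 2 - k - m * k) *
      (1 - q) ^ k * (qFact q m * rfact q (m - k)) := by
  have h3 : (1 : ℝ) - q ≠ 0 := (sub_pos.2 hq1).ne'
  induction k with
  | zero =>
    have := (qFact_pos hq hq1 m).ne'
    simp [qPoch, rfact_natCast, this]
  | succ k ih =>
    have e1 : 1 - q ^ (-(m : ℤ)) * q ^ k = -(q ^ ((k : ℤ) - m) * (1 - q) * qInt q (m - k)) := by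
      have : q ^ ((k : ℤ) - m) * q ^ ((m : ℤ) - k) = 1 := by
        rw [← zpow_add₀ hq.ne']; simp
      have e2 : q ^ (-(m : ℤ)) * q ^ k = q ^ ((k : ℤ) - m) := by
        rw [← zpow_natCast, ← zpow_add₀ hq.ne']
        congr 1
        ring
      rw [e2, qInt]
      field_simp
      linear_combination -this
    have e3 := qInt_mul_rfact hq hq1 ((m : ℤ) - k)
    have e4 : q ^ (((k + 1 : ℕ) : ℤ) ^ 2 - (k + 1 : ℕ) - m * (k + 1 : ℕ)) =
        q ^ k * q ^ ((k : ℤ) ^ 2 - k - m * k) * q ^ ((k : ℤ) - m) := by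
      rw [← zpow_natCast, ← zpow_add₀ hq.ne', ← zpow_add₀ hq.ne']
      congr 1
      push_cast
      ring
    have e5 : (m : ℤ) - (k + 1 : ℕ) = m - k - 1 := by push_cast; ring
    rw [qPoch_succ, e1, e4, e5, ← e3, Nat.choose_succ_succ' k 1, Nat.choose_one_right, pow_add]
    linear_combination (-(q ^ k * (q ^ ((k : ℤ) - m) * (1 - q) * qInt q (m - k)))) * ih

/-- The terminating q-Kummer function. -/
theorem qKummer_inv_pow {q : ℝ} (hq : 0 < q) (hq1 : q < 1) (m r : ℕ) (x : ℝ) :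
    qKummer q (q ^ (-(m : ℤ))) (q ^ (r + 1)) (q ^ (m + r + 1) * x) = qFact q r * qFact q m *
      ∑ k ∈ Finset.range (m + 1), rfact q k * rfact q (m - k) * rfact q (r + k) *
        (q ^ (k * (k + r)) * (-x) ^ k) := by
  have h3 : (1 : ℝ) - q ≠ 0 := (sub_pos.2 hq1).ne'
  have key : ∀ k : ℕ, q ^ k.choose 2 * qPoch (q ^ (-(m : ℤ))) q k /
      (qPoch q q k * qPoch (q ^ (r + 1)) q k) * ((1 - q) * (q ^ (m + r + 1) * x)) ^ k =
      qFact q r * qFact q m * (rfact q k * rfact q (m - k) * rfact q (r + k) *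
        (q ^ (k * (k + r)) * (-x) ^ k)) := by
    intro k
    have f1 := (qFact_pos hq hq1 r).ne'
    have f2 := (qFact_pos hq hq1 k).ne'
    have f3 := (qFact_pos hq hq1 (r + k)).ne'
    have e1 : qPoch (q ^ (r + 1)) q k = (1 - q) ^ k * qFact q (r + k) / qFact q r := by
      rw [eq_div_iff f1, mul_comm, qPoch_pow_succ hq1]
    have e2 : q ^ ((k : ℤ) ^ 2 - k - m * k) * (q ^ (m + r + 1)) ^ k = q ^ (k * (k + r)) := by
      rw [← pow_mul, ← zpow_natCast, ← zpow_natCast, ← zpow_add₀ hq.ne']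
      congr 1
      push_cast
      ring
    rw [qPoch_inv_pow hq hq1, e1, qPoch_self hq1, ← e2, rfact_natCast, ← Nat.cast_add,
      rfact_natCast, mul_pow, mul_pow, neg_pow x]
    field_simp
  rw [qKummer, tsum_eq_sum (s := Finset.range (m + 1)), Finset.mul_sum]
  · exact Finset.sum_congr rfl fun k _ => key k
  · intro k hk
    rw [Finset.mem_range] at hk
    rw [key, rfact_of_neg q (show (m : ℤ) - k < 0 by omega)]
    ring

theorem qKummer_zero_left {q : ℝ} (hq : 0 < q) (hq1 : q < 1) (r : ℕ) (x : ℝ) :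
    qKummer q 0 (q ^ (r + 1)) ((q - 1) * x) = qFact q r *
      ∑' k : ℕ, rfact q k * rfact q (r + k) * (q ^ k.choose 2 * (-x) ^ k) := by
  have h3 : (1 : ℝ) - q ≠ 0 := (sub_pos.2 hq1).ne'
  rw [qKummer, ← tsum_mul_left]
  refine tsum_congr fun k => ?_
  have f1 := (qFact_pos hq hq1 r).ne'
  have f2 := (qFact_pos hq hq1 k).ne'
  have f3 := (qFact_pos hq hq1 (r + k)).ne'
  have e1 : qPoch (q ^ (r + 1)) q k = (1 - q) ^ k * qFact q (r + k) / qFact q r := by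
    rw [eq_div_iff f1, mul_comm, qPoch_pow_succ hq1]
  rw [qPoch_zero_left, e1, qPoch_self hq1, rfact_natCast, ← Nat.cast_add, rfact_natCast,
    show (1 - q) * ((q - 1) * x) = (1 - q) * (1 - q) * -x by ring, mul_pow, mul_pow]
  field_simp

/-! ### Matrix elements of `U` and `U^*` -/

/-- The matrix element of `U_{mn}` at `|k⟩`. -/
def uCoef (h : ℝ) (m n : ℕ) (k : ℤ) : ℝ :=
  √(qFact (h ^ 4) m * qFact (h ^ 4) n * qExp (h ^ 4) (-(h ^ 4) ^ k)) * vSum h k m n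

/-- The Kummer series terminates since its first parameter is `q^(-m)`. Its index is reflected, `p ↦
m - p`, to match the summation index of `vSum`. -/
theorem PhiFun_eq {h : ℝ} (h0 : 0 < h) (h1 : h < 1) (m r : ℕ) (k : ℤ) :
    PhiFun (h ^ 4) m (m + r) ((h ^ 4) ^ k) =
      √(qFact (h ^ 4) m * qFact (h ^ 4) (m + r) * qExp (h ^ 4) (-(h ^ 4) ^ k)) *
      ∑ p ∈ Finset.range (m + 1), rfact (h ^ 4) p * rfact (h ^ 4) (m - p) *
        rfact (h ^ 4) (m + r - p) * ((-1) ^ ((m : ℤ) - p) *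
          h ^ (4 * ((m - p) * (m - p + r) + k * (m - p)) : ℤ)) := by
  have hq : 0 < h ^ 4 := by positivity
  have hq1 : h ^ 4 < 1 := pow_lt_one₀ h0.le h1 (by norm_num)
  have f1 := qFact_pos hq hq1 m
  have f2 := qFact_pos hq hq1 r
  have f3 := qFact_pos hq hq1 (m + r)
  have hE := qExp_neg_pos h0 h1 (x := (h ^ 4) ^ k) (by positivity)
  have e1 : √(qFact (h ^ 4) (m + r) / qFact (h ^ 4) m) * √(qExp (h ^ 4) (-(h ^ 4) ^ k)) *
      qFact (h ^ 4) m =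
      √(qFact (h ^ 4) m * qFact (h ^ 4) (m + r) * qExp (h ^ 4) (-(h ^ 4) ^ k)) := by
    rw [← Real.sqrt_mul (by positivity)]
    conv_lhs =>
      arg 2
      rw [← Real.sqrt_sq f1.le]
    rw [← Real.sqrt_mul (by positivity)]
    congr 1
    field_simp
  rw [PhiFun, show 1 + (m + r) - m = r + 1 by omega, Nat.add_sub_cancel_left,
    qKummer_inv_pow hq hq1, ← e1, ← Finset.sum_range_reflect]
  have e2 : ∀ A B C D S : ℝ, C ≠ 0 → A * (B / C) * (C * D * S) = A * B * D * S := by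
    intros A B C D S hC; field_simp
  rw [e2 _ _ _ _ _ f2.ne']
  congr 1
  refine Finset.sum_congr rfl fun p hp => ?_
  rw [Finset.mem_range] at hp
  obtain ⟨t, rfl⟩ : ∃ t, m = p + t := ⟨m - p, by omega⟩
  rw [show p + t + 1 - 1 - p = t by omega]
  have e3 : (-(h ^ 4) ^ k) ^ t = (-1) ^ t * h ^ (4 * (k * t)) := by
    rw [neg_pow, pow_four_zpow, ← zpow_natCast (h ^ (4 * k)), ← zpow_mul]
    congr 2
    ring
  have e4 : (h ^ 4) ^ (t * (t + r)) * h ^ (4 * (k * t)) =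
      h ^ (4 * (((p + t : ℕ) - p) * ((p + t : ℕ) - p + r) + k * ((p + t : ℕ) - p)) : ℤ) := by
    rw [← pow_mul, ← zpow_natCast, ← zpow_add₀ h0.ne']
    congr 1
    push_cast
    ring
  rw [e3, ← e4, show ((p + t : ℕ) : ℤ) - t = p by push_cast; ring,
    show ((p + t : ℕ) : ℤ) - p = t by push_cast; ring,
    show ((p + t : ℕ) : ℤ) + r - p = r + t by push_cast; ring, zpow_natCast]
  ring

theorem U_single {h : ℝ} (h0 : 0 < h) (h1 : h < 1) (m n : ℕ) (k : ℤ) (a : ℂ) :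
    U (h ^ 4) m n (Finsupp.single k a) =
      Finsupp.single (k + m + n) (((uCoef h m n k : ℝ) : ℂ) * a) := by
  rcases le_or_gt m n with hmn | hmn
  · obtain ⟨r, rfl⟩ := Nat.exists_eq_add_of_le hmn
    have key : h ^ (2 * (r : ℤ) * k + r * (r + 1)) * PhiFun (h ^ 4) m (m + r) ((h ^ 4) ^ k) =
        uCoef h m (m + r) k := by
      rw [PhiFun_eq h0 h1, uCoef, mul_left_comm]
      congr 1
      -- Although `vSum` runs up to `m + r`, the factor `1/(m-p)_q!` cuts it off at `p = m`.
      have : vSum h k m (m + r : ℕ) = ∑ p ∈ Finset.range (m + 1), vTerm h k m (m + r : ℕ) p := by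
        refine (Finset.sum_subset (fun p hp => ?_) fun p _ hp => ?_).symm
        · simp only [Finset.mem_range] at hp ⊢; omega
        · simp only [Finset.mem_range] at hp
          rw [vTerm, rfact_of_neg _ (show (m : ℤ) - p < 0 by omega)]
          ring
      rw [this, Finset.mul_sum]
      refine Finset.sum_congr rfl fun p _ => ?_
      have e : h ^ (2 * (r : ℤ) * k + r * (r + 1)) *
          h ^ (4 * ((m - p) * (m - p + r) + k * (m - p)) : ℤ) =
          h ^ ((m + (m + r : ℕ) - 2 * p : ℤ) ^ 2 + ((m + r : ℕ) - m) +
            2 * k * (m + (m + r : ℕ) - 2 * p)) := by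
        rw [← zpow_add₀ h0.ne']
        congr 1
        push_cast
        ring
      rw [vTerm, ← e]
      push_cast
      ring
    rw [U, if_pos hmn, Module.End.mul_apply, Module.End.mul_apply, etaFun_single,
      Nat.add_sub_cancel_left]
    have := smul_opBStar_pow_single h0 1 r k
      (((PhiFun (h ^ 4) m (m + r) ((h ^ 4) ^ k) : ℝ) : ℂ) * a)
    rw [one_smul] at this
    rw [this, opAPow_single, ← key]
    congr 1
    · push_cast; ring
    · push_cast; ring
  · obtain ⟨r, rfl⟩ := Nat.exists_eq_add_of_le hmn.le
    have key : (h ^ 4) ^ r.choose 2 * ((-1) ^ r * h ^ (2 * (r : ℤ) * k - r * (r - 1)) *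
        PhiFun (h ^ 4) n (n + r) ((h ^ 4) ^ k)) = uCoef h (n + r) n k := by
      have e0 : ∀ A B C S : ℝ, A * (B * (C * S)) = C * (A * (B * S)) := by intros; ring
      rw [PhiFun_eq h0 h1, uCoef, mul_comm (qFact (h ^ 4) (n + r)), e0]
      congr 1
      rw [vSum, Int.toNat_natCast, Finset.mul_sum, Finset.mul_sum]
      refine Finset.sum_congr rfl fun p _ => ?_
      have h2 := two_mul_choose_two_cast r
      have e : (h ^ 4) ^ r.choose 2 * h ^ (2 * (r : ℤ) * k - r * (r - 1)) *
          h ^ (4 * ((n - p) * (n - p + r) + k * (n - p)) : ℤ) =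
          h ^ (((n + r : ℕ) + n - 2 * p : ℤ) ^ 2 + (n - (n + r : ℕ)) +
            2 * k * ((n + r : ℕ) + n - 2 * p)) := by
        rw [← pow_mul, ← zpow_natCast, ← zpow_add₀ h0.ne', ← zpow_add₀ h0.ne']
        congr 1
        push_cast
        linear_combination 2 * h2
      have e2 : (-1 : ℝ) ^ (((n + r : ℕ) : ℤ) - p) = (-1) ^ r * (-1) ^ ((n : ℤ) - p) := by
        rw [← zpow_natCast, ← zpow_add₀ (by norm_num)]
        congr 1
        push_cast
        ring
      rw [vTerm, ← e, e2]
      push_cast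
      ring
    rw [U, if_neg (not_le.2 hmn), LinearMap.smul_apply, Module.End.mul_apply, Module.End.mul_apply,
      etaFun_single, Nat.add_sub_cancel_left]
    have := smul_opB_pow_single h0 (-1) r k
      (((PhiFun (h ^ 4) n (n + r) ((h ^ 4) ^ k) : ℝ) : ℂ) * a)
    rw [show (-1 : ℂ) • opB (h ^ 4) = -opB (h ^ 4) from LinearMap.ext fun x => by simp] at this
    rw [this, opAPow_single, ← key, Finsupp.smul_single, smul_eq_mul]
    congr 1
    · push_cast; ring
    · push_cast; ring

/-- Read off from `U_single` by adjointness; the matrix elements are real, so conjugation has no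
effect. -/
theorem UStar_single {h : ℝ} (h0 : 0 < h) (h1 : h < 1) (m s : ℕ) (k : ℤ) (a : ℂ) :
    UStar (h ^ 4) m s (Finsupp.single k a) =
      Finsupp.single (k - s - m) (((uCoef h s m (k - s - m) : ℝ) : ℂ) * a) := by
  have hs : ∀ i : ℤ, toL2 (Finsupp.single i 1) = lp.single 2 i (1 : ℂ) := by
    intro i; simp [toL2]
  have key : UStar (h ^ 4) m s (Finsupp.single k 1) =
      Finsupp.single (k - s - m) ((uCoef h s m (k - s - m) : ℝ) : ℂ) := by
    ext i
    have := inner_UStar (h ^ 4) m s (Finsupp.single k 1) (Finsupp.single i 1)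
    rw [U_single h0 h1, hs, hs, lp.inner_single_left, lp.inner_single_right, toL2_apply,
      toL2_apply] at this
    simp only [RCLike.inner_apply, map_one, mul_one, one_mul] at this
    have h2 := congrArg (starRingEnd ℂ) this
    rw [Complex.conj_conj] at h2
    rw [h2, Finsupp.single_apply, Finsupp.single_apply]
    by_cases hi : k - s - m = i
    · subst hi
      rw [if_pos rfl, if_pos (by ring), Complex.conj_ofReal]
    · rw [if_neg hi, if_neg (by omega), map_zero]
  rw [show Finsupp.single k a = a • Finsupp.single k (1 : ℂ) by simp, map_smul, key,
    Finsupp.smul_single, smul_eq_mul, mul_comm]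

/-! ### The transformed basis -/

theorem uCoef_zero_right {h : ℝ} (h0 : 0 < h) (h1 : h < 1) (r : ℕ) (k : ℤ) :
    uCoef h r 0 k = (qFact (h ^ 4) r)⁻¹ * ((-1) ^ r * √(qFact (h ^ 4) r) *
      h ^ (2 * k * r + r * (r - 1) : ℤ) * √(qExp (h ^ 4) (-(h ^ 4) ^ k))) := by
  have f := qFact_pos (q := h ^ 4) (by positivity) (pow_lt_one₀ h0.le h1 (by norm_num)) r
  rw [uCoef, Nat.cast_zero, vSum_zero_right, qFact_zero, mul_one, Real.sqrt_mul f.le,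
    rfact_natCast, zpow_natCast, show (r : ℤ) ^ 2 - r + 2 * k * r = 2 * k * r + r * (r - 1) by ring]
  ring

/-- The `r`-th power lives in the Fock component `r` alone, so in each component the series for the
ground state has one nonzero term. -/
theorem ground_term {h : ℝ} (h0 : 0 < h) (k : ℤ) (a : ℂ) (r : ℕ) :
    ((-(onZ (opAPow (-1) * opB (h ^ 4)) * onFockZStar (h ^ 4))) ^ r)
      (Pi.single 0 (Finsupp.single k a)) = Pi.single r (Finsupp.single (k + r)
        ((((-1) ^ r * √(qFact (h ^ 4) r) * h ^ (2 * k * r + r * (r - 1) : ℤ) : ℝ) : ℂ) * a)) := by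
  induction r with
  | zero => simp [qFact_zero]
  | succ r ih =>
    rw [pow_succ', Module.End.mul_apply, ih]
    funext m
    rw [LinearMap.neg_apply, Pi.neg_apply, Module.End.mul_apply]
    simp only [onZ, LinearMap.compLeft_apply, onFockZStar, LinearMap.coe_mk, AddHom.coe_mk,
      Function.comp]
    rcases eq_or_ne m (r + 1) with rfl | hm
    · rw [Nat.add_sub_cancel, Pi.single_eq_same, Pi.single_eq_same, Finsupp.smul_single,
        Module.End.mul_apply, opB_single h0, opAPow_single, ← Finsupp.single_neg]
      congr 1
      · push_cast; ring
      · have e : h ^ (2 * k * (r + 1 : ℕ) + (r + 1 : ℕ) * ((r + 1 : ℕ) - 1) : ℤ) =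
            h ^ (2 * (k + r)) * h ^ (2 * k * r + r * (r - 1) : ℤ) := by
          rw [← zpow_add₀ h0.ne']
          congr 1
          push_cast
          ring
        have e2 : √(qFact (h ^ 4) (r + 1)) = √(qFact (h ^ 4) r) * √(qNum (h ^ 4) (r + 1)) := by
          rw [qFact_succ, Real.sqrt_mul]
          refine Finset.prod_nonneg fun i _ => ?_
          rw [qNum, ← neg_div_neg_eq]
          rcases le_total (h ^ 4) 1 with hle | hle
          · rw [neg_div_neg_eq]
            exact div_nonneg (sub_nonneg.2 (pow_le_one₀ (by positivity) hle)) (sub_nonneg.2 hle)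
          · exact div_nonneg (by linarith [one_le_pow₀ hle (n := i + 1)]) (by linarith)
        rw [e, e2, smul_eq_mul]
        push_cast
        ring
    · rw [Pi.single_eq_of_ne hm]
      rcases m with _ | m
      · simp [qNum]
      · rw [Nat.add_sub_cancel, Pi.single_eq_of_ne (by omega)]
        simp

theorem ground_apply {h : ℝ} (h0 : 0 < h) (h1 : h < 1) (k : ℤ) (m : ℕ) :
    ground (h ^ 4) k m = Finsupp.single (k + m) ((uCoef h m 0 k : ℝ) : ℂ) := by
  rw [ground, etaFun_single]
  simp only [ground_term h0]
  rw [finsum_eq_single _ m fun r hr => by rw [Pi.single_eq_of_ne hr.symm, smul_zero],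
    Pi.single_eq_same, Finsupp.smul_single, uCoef_zero_right h0 h1]
  congr 1
  push_cast
  simp only [smul_eq_mul]
  ring

theorem uCoef_succ_right {h : ℝ} (h0 : 0 < h) (h1 : h < 1) (m n : ℕ) (k : ℤ) :
    √(qFact (h ^ 4) (n + 1)) * uCoef h m (n + 1) k = √(qFact (h ^ 4) n) *
      (h ^ (2 * (k + n + m + 1)) * uCoef h m n k + √(qNum (h ^ 4) m) * uCoef h (m - 1) n k) := by
  have hq : 0 < h ^ 4 := by positivity
  have hq1 : h ^ 4 < 1 := pow_lt_one₀ h0.le h1 (by norm_num)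
  have hE := (qExp_neg_pos h0 h1 (x := (h ^ 4) ^ k) (by positivity)).le
  have fm := qFact_pos hq hq1
  have hn := qNum_succ_pos hq hq1
  have hu : ∀ m n : ℕ, uCoef h m n k = √(qFact (h ^ 4) m) * √(qFact (h ^ 4) n) *
      √(qExp (h ^ 4) (-(h ^ 4) ^ k)) * vSum h k m n := fun m n => by
    rw [uCoef, Real.sqrt_mul (mul_nonneg (fm m).le (fm n).le), Real.sqrt_mul (fm m).le]
  have e1 : √(qFact (h ^ 4) (n + 1)) * √(qFact (h ^ 4) (n + 1)) =
      √(qFact (h ^ 4) n) * √(qFact (h ^ 4) n) * qInt (h ^ 4) (n + 1) := by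
    rw [Real.mul_self_sqrt (fm _).le, Real.mul_self_sqrt (fm _).le, qFact_succ, ← Nat.cast_succ,
      qInt_natCast]
  have R := vSum_succ_right h0 h1 k m n
  have e2 : √(qNum (h ^ 4) m) * √(qFact (h ^ 4) (m - 1)) * vSum h k (m - 1 : ℕ) n =
      √(qFact (h ^ 4) m) * vSum h k (m - 1) n := by
    -- At `m = 0` the truncated `m - 1` is harmless: `√(0)_q = 0` on the left, and the row `-1`
    -- vanishes on the right.
    rcases m with _ | m
    · rw [vSum_of_neg_left h k n (show ((0 : ℕ) : ℤ) - 1 < 0 by simp)]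
      simp [qNum]
    · rw [Nat.add_sub_cancel, qFact_succ, Real.sqrt_mul (fm m).le, Nat.cast_succ,
        add_sub_cancel_right]
      ring
  rw [hu, hu, hu, Nat.cast_succ]
  rw [show k + (n : ℤ) + m + 1 = k + n + m + 1 by ring] at R
  linear_combination (√(qFact (h ^ 4) m) * √(qExp (h ^ 4) (-(h ^ 4) ^ k)) * vSum h k m (n + 1)) * e1
    + (√(qFact (h ^ 4) n) * √(qFact (h ^ 4) n) * √(qFact (h ^ 4) m) *
      √(qExp (h ^ 4) (-(h ^ 4) ^ k))) * R - (√(qFact (h ^ 4) n) * √(qFact (h ^ 4) n) *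
      √(qExp (h ^ 4) (-(h ^ 4) ^ k))) * e2

theorem deltaZStar_pow_ground {h : ℝ} (h0 : 0 < h) (h1 : h < 1) (n : ℕ) (k : ℤ) :
    (deltaZStar (h ^ 4) ^ n) (ground (h ^ 4) k) = fun m : ℕ =>
      Finsupp.single (k + m + n) ((√(qFact (h ^ 4) n) * uCoef h m n k : ℝ) : ℂ) := by
  induction n with
  | zero =>
    funext m
    simp [ground_apply h0 h1, qFact_zero]
  | succ n ih =>
    rw [pow_succ', Module.End.mul_apply, ih]
    funext m
    rw [uCoef_succ_right h0 h1, deltaZStar, LinearMap.add_apply, Pi.add_apply,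
      Module.End.mul_apply]
    simp only [onZ, LinearMap.compLeft_apply, onFockZStar, LinearMap.coe_mk, AddHom.coe_mk,
      Function.comp]
    rw [opBStar_single h0, Finsupp.smul_single, opAPow_single]
    rcases m with _ | m
    · have : √(qNum (h ^ 4) 0) = 0 := by simp [qNum]
      rw [this]
      simp only [Complex.ofReal_zero, zero_smul, Finsupp.single_zero, add_zero, zero_mul]
      congr 1
      · push_cast; ring
      · rw [show k + ((0 : ℕ) : ℤ) + n + 1 = k + n + (0 : ℕ) + 1 by ring]
        push_cast
        ring
    · rw [Nat.add_sub_cancel, show k + (m : ℤ) + n - 2 * -1 = k + (m + 1 : ℕ) + (n + 1 : ℕ) by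
        push_cast; ring, show k + ((m + 1 : ℕ) : ℤ) + n + 1 = k + (m + 1 : ℕ) + (n + 1 : ℕ) by
        push_cast; ring, ← Finsupp.single_add]
      congr 1
      rw [show k + ((m + 1 : ℕ) : ℤ) + (n + 1 : ℕ) = k + n + (m + 1 : ℕ) + 1 by push_cast; ring,
        smul_eq_mul]
      push_cast
      ring

theorem primed_apply {h : ℝ} (h0 : 0 < h) (h1 : h < 1) (n m : ℕ) (k : ℤ) :
    primed (h ^ 4) n k m = U (h ^ 4) m n (Finsupp.single k 1) := by
  have f := qFact_pos (q := h ^ 4) (by positivity) (pow_lt_one₀ h0.le h1 (by norm_num)) n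
  have f' : ((√(qFact (h ^ 4) n) : ℝ) : ℂ) ≠ 0 := by exact_mod_cast (Real.sqrt_pos.2 f).ne'
  rw [U_single h0 h1, primed, deltaZStar_pow_ground h0 h1, Pi.smul_apply, Finsupp.smul_single,
    smul_eq_mul, mul_one]
  congr 1
  push_cast
  field_simp

/-! ### Matrix elements of `t_{ij}` -/

theorem tauSum_natCast {h : ℝ} (h0 : 0 < h) (lam : ℝ) (r : ℕ) (κ : ℤ) :
    tauSum h (Complex.I * lam) r κ = (Complex.I * lam) ^ r * ((h ^ (r * (1 + 2 * κ)) *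
      ∑' k : ℕ, rfact (h ^ 4) k * rfact (h ^ 4) (r + k) *
        ((h ^ 4) ^ k.choose 2 * (-(h ^ (4 * (κ + 1)) * lam ^ 2)) ^ k) : ℝ) : ℂ) := by
  rw [tauSum, Complex.ofReal_mul, Complex.ofReal_tsum, ← mul_assoc, ← tsum_mul_left]
  refine tsum_congr fun k => ?_
  have e1 : h ^ (2 * (k : ℤ) ^ 2 + (2 * k + r) * (1 + 2 * κ)) =
      h ^ (r * (1 + 2 * κ)) * ((h ^ 4) ^ k.choose 2 * (h ^ (4 * (κ + 1))) ^ k) := by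
    have h2 := two_mul_choose_two_cast k
    rw [← pow_mul, ← zpow_natCast, ← zpow_natCast (h ^ (4 * (κ + 1))), ← zpow_mul,
      ← zpow_add₀ h0.ne', ← zpow_add₀ h0.ne']
    congr 1
    push_cast
    linear_combination (-2) * h2
  have e2 : (Complex.I * lam) ^ (2 * k + r) =
      (Complex.I * lam) ^ r * (-1) ^ k * ((lam : ℂ) ^ 2) ^ k := by
    rw [pow_add, pow_mul, mul_pow, Complex.I_sq, mul_pow]
    ring
  rw [tauTerm, e1, show (2 * (k : ℤ) + r).toNat = 2 * k + r by omega, e2, neg_pow,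
    add_comm (k : ℤ) r]
  push_cast
  ring

/-- The summand is symmetric in `e` and `e + d`. Terms with `e < r` vanish, and `e = f + r`
exchanges the two factorials. This reduces the case `j < i` of `t_{ji}` to nonnegative `d`. -/
theorem tauSum_neg_natCast (h : ℝ) (μ : ℂ) (r : ℕ) (κ : ℤ) :
    tauSum h μ (-r) κ = tauSum h μ r (κ + r) := by
  rw [tauSum, ← (add_left_injective r).tsum_eq (f := tauTerm h μ (-r) κ), tauSum]
  · refine tsum_congr fun f => ?_
    have e : h ^ (2 * ((f + r : ℕ) : ℤ) ^ 2 + (2 * (f + r : ℕ) + -r) * (1 + 2 * κ)) =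
        h ^ (2 * (f : ℤ) ^ 2 + (2 * f + r) * (1 + 2 * (κ + r))) := by
      congr 1
      push_cast
      ring
    simp only [tauTerm]
    rw [e, show ((f + r : ℕ) : ℤ) + -r = f by push_cast; ring,
      show 2 * ((f + r : ℕ) : ℤ) + -r = 2 * f + r by push_cast; ring, Nat.cast_add,
      mul_comm (rfact (h ^ 4) (f + r))]
  · intro e he
    by_contra hcon
    refine he ?_
    have : (e : ℤ) + -r < 0 := by
      by_contra hge
      exact hcon ⟨e - r, by simp only []; omega⟩
    rw [tauTerm, rfact_of_neg _ this]
    simp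

theorem t_single {h : ℝ} (h0 : 0 < h) (h1 : h < 1) (lam : ℝ) (j i k : ℤ) (a : ℂ) :
    t (h ^ 4) lam j i (Finsupp.single k a) =
      Finsupp.single (k - j - i) (tauSum h (Complex.I * lam) (j - i) (k - i) * a) := by
  have hq : 0 < h ^ 4 := by positivity
  have hq1 : h ^ 4 < 1 := pow_lt_one₀ h0.le h1 (by norm_num)
  have ht : (h ^ 4) ^ (((j : ℝ) ^ 2 - (i : ℝ) ^ 2) / 4) = h ^ (j ^ 2 - i ^ 2) :=
    rpow_eq_zpow h0 (by push_cast; ring)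
  have hK : ∀ (r : ℕ) (z : ℤ), qKummer (h ^ 4) 0 ((h ^ 4) ^ (r + 1))
      ((h ^ 4 - 1) * (h ^ 4) ^ (1 - z) * (lam ^ 2 * (h ^ 4) ^ k)) = qFact (h ^ 4) r *
      ∑' e : ℕ, rfact (h ^ 4) e * rfact (h ^ 4) (r + e) *
        ((h ^ 4) ^ e.choose 2 * (-(h ^ (4 * (k - z + 1)) * lam ^ 2)) ^ e) := by
    intro r z
    rw [← qKummer_zero_left hq hq1]
    congr 1
    rw [show 4 * (k - z + 1) = 4 * (1 - z) + 4 * k by ring, zpow_add₀ h0.ne', pow_four_zpow,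
      pow_four_zpow]
    ring
  rcases le_or_gt i j with hij | hij
  · obtain ⟨r, hr⟩ : ∃ r : ℕ, j = i + r := ⟨(j - i).toNat, by omega⟩
    have f := (qFact_pos hq hq1 r).ne'
    rw [t, if_pos hij, ht, show (j - i).toNat = r by omega,
      show 1 + j - i = ((r + 1 : ℕ) : ℤ) by push_cast; omega, zpow_natCast, LinearMap.smul_apply,
      Module.End.mul_apply, Module.End.mul_apply, etaFun_single, opAPow_single,
      smul_opB_pow_single h0, Finsupp.smul_single, hK, show j - i = r by omega, tauSum_natCast h0]
    congr 1
    · omega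
    · have e : h ^ (r * (1 + 2 * (k - i))) =
          h ^ (j ^ 2 - i ^ 2) * h ^ (2 * r * (k - 2 * i) - r * (r - 1) : ℤ) := by
        rw [← zpow_add₀ h0.ne', hr]
        congr 1
        ring
      rw [e, smul_eq_mul]
      generalize (∑' e : ℕ, rfact (h ^ 4) e * rfact (h ^ 4) (r + e) *
        ((h ^ 4) ^ e.choose 2 * (-(h ^ (4 * (k - i + 1)) * lam ^ 2)) ^ e)) = S
      have f' : (qFact (h ^ 4) r : ℂ) ≠ 0 := by exact_mod_cast f
      push_cast
      field_simp
  · obtain ⟨r, hr⟩ : ∃ r : ℕ, i = j + r := ⟨(i - j).toNat, by omega⟩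
    have f := (qFact_pos hq hq1 r).ne'
    rw [t, if_neg (not_le.2 hij), ht, show (i - j).toNat = r by omega,
      show 1 + i - j = ((r + 1 : ℕ) : ℤ) by push_cast; omega, zpow_natCast, LinearMap.smul_apply,
      Module.End.mul_apply, Module.End.mul_apply, etaFun_single, smul_opBStar_pow_single h0,
      opAPow_single, Finsupp.smul_single, hK, show j - i = -r by omega, tauSum_neg_natCast h,
      tauSum_natCast h0, show k - i + r = k - j by omega]
    congr 1
    · omega
    · have e : h ^ (r * (1 + 2 * (k - j))) =
          h ^ (j ^ 2 - i ^ 2) * h ^ (2 * r * k + r * (r + 1) : ℤ) := by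
        rw [← zpow_add₀ h0.ne', hr]
        congr 1
        ring
      rw [e, smul_eq_mul]
      generalize (∑' e : ℕ, rfact (h ^ 4) e * rfact (h ^ 4) (r + e) *
        ((h ^ 4) ^ e.choose 2 * (-(h ^ (4 * (k - j + 1)) * lam ^ 2)) ^ e)) = S
      have f' : (qFact (h ^ 4) r : ℂ) ≠ 0 := by exact_mod_cast f
      push_cast
      field_simp

/-! ### Matrix elements of `D_j` -/

theorem zetaFun_single (q : ℝ) (F : ℝ → ℂ) (n : ℕ) (a : ℂ) :
    zetaFun q F (Finsupp.single n a) = Finsupp.single n (F (q ^ n) * a) := by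
  simp [zetaFun, Finsupp.linearCombination_single, mul_comm]

theorem opZ_pow_single {q : ℝ} (hq : 0 < q) (hq1 : q < 1) (J s : ℕ) (a : ℂ) :
    (opZ q ^ J) (Finsupp.single (s + J) a) =
      Finsupp.single s (((√(qFact q (s + J)) / √(qFact q s) : ℝ) : ℂ) * a) := by
  have f := fun n => (Real.sqrt_pos.2 (qFact_pos hq hq1 n)).ne'
  induction J generalizing a with
  | zero => simp [f]
  | succ J ih =>
    rw [pow_succ, Module.End.mul_apply, opZ, Finsupp.linearCombination_single, ← opZ,
      Finsupp.smul_single, ← add_assoc, Nat.add_sub_cancel, ih, qFact_succ,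
      Real.sqrt_mul (qFact_pos hq hq1 _).le, smul_eq_mul]
    congr 1
    push_cast
    ring

theorem opZStar_pow_single {q : ℝ} (hq : 0 < q) (hq1 : q < 1) (J s : ℕ) (a : ℂ) :
    (opZStar q ^ J) (Finsupp.single s a) =
      Finsupp.single (s + J) (((√(qFact q (s + J)) / √(qFact q s) : ℝ) : ℂ) * a) := by
  have f := fun n => (Real.sqrt_pos.2 (qFact_pos hq hq1 n)).ne'
  induction J with
  | zero => simp [f]
  | succ J ih =>
    rw [pow_succ', Module.End.mul_apply, ih, opZStar, Finsupp.linearCombination_single,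
      Finsupp.smul_single, ← add_assoc, qFact_succ, Real.sqrt_mul (qFact_pos hq hq1 _).le,
      smul_eq_mul]
    congr 1
    push_cast
    ring

theorem dTerm_swap (h : ℝ) (μ : ℂ) (s l p : ℤ) : dTerm h μ s l (s - l + p) = dTerm h μ l s p := by
  rw [dTerm, dTerm, show s - (s - l + p) = l - p by ring,
    show l - s + (s - l + p) = p by ring, show l - s + 2 * (s - l + p) = s - l + 2 * p by ring]
  push_cast
  ring

/-- `D_{-J}` is the transpose of `D_J`: the reflection in `dTerm_swap` exchanges the powers of `z`
and `z*`. Entries below the diagonal thus reduce to those above it. -/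
theorem dSum_add_left (h : ℝ) (μ : ℂ) (s J : ℕ) :
    dSum h μ (s + J : ℕ) s = dSum h μ s (s + J : ℕ) := by
  rw [dSum, dSum, Int.toNat_natCast, Int.toNat_natCast, show s + J + 1 = J + (s + 1) by ring,
    Finset.sum_range_add, Finset.sum_eq_zero, zero_add]
  · refine Finset.sum_congr rfl fun p _ => ?_
    rw [← dTerm_swap]
    congr 1
    push_cast
    ring
  · intro p hp
    rw [Finset.mem_range] at hp
    rw [dTerm, rfact_of_neg _ (show (s : ℤ) - (s + J : ℕ) + p < 0 by push_cast; omega)]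
    simp

theorem fFun_eq {h : ℝ} (h0 : 0 < h) (h1 : h < 1) (lam : ℝ) (J s : ℕ) :
    fFun (h ^ 4) lam J ((h ^ 4) ^ s) =
      (qFact (h ^ 4) s : ℂ) * dSum h (Complex.I * lam) s (s + J : ℕ) := by
  have hq : 0 < h ^ 4 := by positivity
  have hq1 : h ^ 4 < 1 := pow_lt_one₀ h0.le h1 (by norm_num)
  have f' : (qFact (h ^ 4) J : ℂ) ≠ 0 := by exact_mod_cast (qFact_pos hq hq1 J).ne'
  have e0 : (h ^ 4) ^ (J + 1) * lam ^ 2 * (h ^ 4) ^ s = (h ^ 4) ^ (s + J + 1) * lam ^ 2 := by ring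
  have ht : (h ^ 4) ^ ((J : ℝ) ^ 2 / 4) = h ^ ((J : ℤ) ^ 2) := rpow_eq_zpow h0 (by push_cast; ring)
  rw [fFun, ht, ← zpow_natCast (h ^ 4) s, ← zpow_neg, zpow_natCast, e0, qKummer_inv_pow hq hq1, dSum,
    Int.toNat_natCast, Complex.ofReal_mul, Complex.ofReal_mul, Complex.ofReal_sum, Finset.mul_sum,
    Finset.mul_sum, Finset.mul_sum]
  refine Finset.sum_congr rfl fun p _ => ?_
  have e1 : h ^ ((((s + J : ℕ) : ℤ) - s + 2 * p) ^ 2) =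
      h ^ ((J : ℤ) ^ 2) * (h ^ 4) ^ (p * (p + J)) := by
    rw [← pow_mul, ← zpow_natCast, ← zpow_add₀ h0.ne']
    congr 1
    push_cast
    ring
  have e2 : (Complex.I * lam) ^ (((s + J : ℕ) : ℤ) - s + 2 * p).toNat =
      (Complex.I * lam) ^ J * (-1) ^ p * ((lam : ℂ) ^ 2) ^ p := by
    rw [show (((s + J : ℕ) : ℤ) - s + 2 * p).toNat = 2 * p + J by push_cast; omega, pow_add,
      pow_mul, mul_pow, Complex.I_sq, mul_pow]
    ring
  rw [dTerm, e1, e2, neg_pow, show ((s + J : ℕ) : ℤ) - s + p = J + p by push_cast; ring]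
  push_cast
  field_simp

theorem DMat_eq {h : ℝ} (h0 : 0 < h) (h1 : h < 1) (lam : ℝ) (s l : ℕ) :
    DMat (h ^ 4) lam ((l : ℤ) - s) s l =
      ((√(qFact (h ^ 4) s) * √(qFact (h ^ 4) l) : ℝ) : ℂ) * dSum h (Complex.I * lam) s l := by
  have hq : 0 < h ^ 4 := by positivity
  have hq1 : h ^ 4 < 1 := pow_lt_one₀ h0.le h1 (by norm_num)
  have hs : ∀ s J : ℕ, ((√(qFact (h ^ 4) (s + J)) / √(qFact (h ^ 4) s) : ℝ) : ℂ) *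
      (qFact (h ^ 4) s : ℂ) = ((√(qFact (h ^ 4) s) * √(qFact (h ^ 4) (s + J)) : ℝ) : ℂ) := by
    intro s J
    rw [← Complex.ofReal_mul]
    congr 1
    have f := Real.sqrt_pos.2 (qFact_pos hq hq1 s)
    rw [div_mul_eq_mul_div, div_eq_iff f.ne']
    linear_combination (-√(qFact (h ^ 4) (s + J))) * Real.mul_self_sqrt (qFact_pos hq hq1 s).le
  rcases le_or_gt s l with hsl | hsl
  · obtain ⟨J, rfl⟩ := Nat.exists_eq_add_of_le hsl
    rw [DMat, D, if_pos (by push_cast; omega),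
      show (((s + J : ℕ) : ℤ) - s).toNat = J by push_cast; omega, Module.End.mul_apply,
      opZ_pow_single hq hq1, zetaFun_single, Finsupp.single_eq_same, fFun_eq h0 h1, ← hs]
    ring
  · obtain ⟨J, rfl⟩ := Nat.exists_eq_add_of_le hsl.le
    rw [DMat, D, if_neg (by push_cast; omega),
      show (-((l : ℤ) - (l + J : ℕ))).toNat = J by push_cast; omega, Module.End.mul_apply,
      zetaFun_single, opZStar_pow_single hq hq1, Finsupp.single_eq_same, fFun_eq h0 h1,
      dSum_add_left, mul_comm √(qFact (h ^ 4) (l + J)), ← hs]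
    ring

/-! ### The addition theorem -/

/-- The target vector does not depend on `s` and `l`, so convergence in `ℓ²(ℤ)` reduces to that of a
scalar series. The roots of `(s)_q!` and `(l)_q!` from `D` pair with those in `U*` and `U` to give
the full weights `(s)_q!` and `(l)_q!`. -/
theorem double_term_single {h : ℝ} (h0 : 0 < h) (h1 : h < 1) (lam : ℝ) (j k : ℤ) (m n s l : ℕ)
    (a : ℂ) :
    DMat (h ^ 4) lam ((l : ℤ) - s) s l • toL2 ((UStar (h ^ 4) m s *
      t (h ^ 4) lam j ((l : ℤ) - s) * U (h ^ 4) l n) (Finsupp.single k a)) =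
    (((√(qFact (h ^ 4) m * qExp (h ^ 4) (-(h ^ 4) ^ (k + n - j - m))) *
        √(qFact (h ^ 4) n * qExp (h ^ 4) (-(h ^ 4) ^ k)) : ℝ) : ℂ) *
      (dSum h (Complex.I * lam) s l * tauSum h (Complex.I * lam) (j - l + s) (k + n + s) *
      ((qFact (h ^ 4) l * vSum h k l n : ℝ) : ℂ) *
      ((qFact (h ^ 4) s * vSum h (k + n - j - m) s m : ℝ) : ℂ))) •
        toL2 (Finsupp.single (k + n - j - m) a) := by
  have hq : 0 < h ^ 4 := by positivity
  have hq1 : h ^ 4 < 1 := pow_lt_one₀ h0.le h1 (by norm_num)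
  have f := fun n => (qFact_pos hq hq1 n).le
  have hu : ∀ (s m : ℕ) (k : ℤ), √(qFact (h ^ 4) s) * uCoef h s m k =
      √(qFact (h ^ 4) m * qExp (h ^ 4) (-(h ^ 4) ^ k)) * (qFact (h ^ 4) s * vSum h k s m) := by
    intro s m k
    rw [uCoef, mul_assoc (qFact (h ^ 4) s), Real.sqrt_mul (f s)]
    linear_combination (√(qFact (h ^ 4) m * qExp (h ^ 4) (-(h ^ 4) ^ k)) * vSum h k s m) *
      Real.mul_self_sqrt (f s)
  rw [Module.End.mul_apply, Module.End.mul_apply, U_single h0 h1, t_single h0 h1,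
    UStar_single h0 h1, DMat_eq h0 h1, ← map_smul, ← map_smul, Finsupp.smul_single,
    Finsupp.smul_single, show k + l + n - j - (l - s) - s - m = k + n - j - m by ring,
    show k + l + n - (l - s : ℤ) = k + n + s by ring, show j - ((l : ℤ) - s) = j - l + s by ring,
    smul_eq_mul, smul_eq_mul]
  congr 2
  have e : √(qFact (h ^ 4) s) * √(qFact (h ^ 4) l) * uCoef h s m (k + n - j - m) * uCoef h l n k =
      √(qFact (h ^ 4) m * qExp (h ^ 4) (-(h ^ 4) ^ (k + n - j - m))) *
        √(qFact (h ^ 4) n * qExp (h ^ 4) (-(h ^ 4) ^ k)) * (qFact (h ^ 4) l * vSum h k l n) *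
        (qFact (h ^ 4) s * vSum h (k + n - j - m) s m) := by
    linear_combination (√(qFact (h ^ 4) l) * uCoef h l n k) * hu s m (k + n - j - m) +
      (√(qFact (h ^ 4) m * qExp (h ^ 4) (-(h ^ 4) ^ (k + n - j - m))) *
        (qFact (h ^ 4) s * vSum h (k + n - j - m) s m)) * hu l n k
  have e' := congrArg (fun x : ℝ => (x : ℂ)) e
  simp only [Complex.ofReal_mul] at e' ⊢
  linear_combination (dSum h (Complex.I * lam) s l *
    tauSum h (Complex.I * lam) (j - l + s) (k + n + s) * a) * e'

theorem hasSum_single {h : ℝ} (h0 : 0 < h) (h1 : h < 1) (lam : ℝ) (j k : ℤ) (m n : ℕ) (a : ℂ) :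
    HasSum (fun p : ℕ × ℕ => DMat (h ^ 4) lam ((p.2 : ℤ) - (p.1 : ℤ)) p.1 p.2 •
        toL2 ((UStar (h ^ 4) m p.1 * t (h ^ 4) lam j ((p.2 : ℤ) - (p.1 : ℤ)) * U (h ^ 4) p.2 n)
          (Finsupp.single k a)))
      ((DMat (h ^ 4) lam j m n * (if j = (n : ℤ) - (m : ℤ) then 1 else 0)) •
        toL2 (Finsupp.single k a)) := by
  have hq : 0 < h ^ 4 := by positivity
  have hq1 : h ^ 4 < 1 := pow_lt_one₀ h0.le h1 (by norm_num)
  simp only [double_term_single h0 h1]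
  have H := ((hasSum_double h0 h1 (Complex.I * lam) j k m n).mul_left
    (((√(qFact (h ^ 4) m * qExp (h ^ 4) (-(h ^ 4) ^ (k + n - j - m))) *
        √(qFact (h ^ 4) n * qExp (h ^ 4) (-(h ^ 4) ^ k)) : ℝ) : ℂ))).smul_const
        (toL2 (Finsupp.single (k + n - j - m) a))
  convert H using 1
  split_ifs with hj
  · have hE := qExp_neg_pos h0 h1 (x := (h ^ 4) ^ k) (by positivity)
    -- The two roots of `e_q^(-q^k)` from `U*` and `U` cancel against the norm in `pairing_eq`,
    -- leaving the normalisation of `DMat_eq`.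
    have e : √(qFact (h ^ 4) m * qExp (h ^ 4) (-(h ^ 4) ^ k)) *
        √(qFact (h ^ 4) n * qExp (h ^ 4) (-(h ^ 4) ^ k)) * (qExp (h ^ 4) (-(h ^ 4) ^ k))⁻¹ =
        √(qFact (h ^ 4) m) * √(qFact (h ^ 4) n) := by
      rw [Real.sqrt_mul (qFact_pos hq hq1 m).le, Real.sqrt_mul (qFact_pos hq hq1 n).le,
        mul_inv_eq_iff_eq_mul₀ hE.ne']
      linear_combination (√(qFact (h ^ 4) m) * √(qFact (h ^ 4) n)) * Real.mul_self_sqrt hE.le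
    rw [hj, DMat_eq h0 h1, show k + n - ((n : ℤ) - m) - m = k by ring, mul_one, ← e]
    congr 1
    push_cast
    ring
  · simp

end QPlane

end

theorem mainTheorem3 (q lam : ℝ) (hq0 : 0 < q) (hq1 : q < 1) :
    (∀ (m n : ℕ) (k : ℤ), QPlane.primed q n k m = QPlane.U q m n (Finsupp.single k 1)) ∧
    ∀ (j : ℤ) (m n : ℕ) (ψ : ℤ →₀ ℂ),
      HasSum
        (fun p : ℕ × ℕ =>
          QPlane.DMat q lam ((p.2 : ℤ) - (p.1 : ℤ)) p.1 p.2 •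
            QPlane.toL2
              ((QPlane.UStar q m p.1 * QPlane.t q lam j ((p.2 : ℤ) - (p.1 : ℤ)) *
                QPlane.U q p.2 n) ψ))
        ((QPlane.DMat q lam j m n * (if j = (n : ℤ) - (m : ℤ) then 1 else 0)) •
          QPlane.toL2 ψ) := by
  -- The fourth root is taken because `q^((i²-j²)/4)` and `q^(j²/4)` occur.
  obtain ⟨h, h0, h1, rfl⟩ : ∃ h : ℝ, 0 < h ∧ h < 1 ∧ q = h ^ 4 := by
    refine ⟨q ^ (1 / 4 : ℝ), Real.rpow_pos_of_pos hq0 _,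
      Real.rpow_lt_one hq0.le hq1 (by norm_num), ?_⟩
    rw [← Real.rpow_natCast, ← Real.rpow_mul hq0.le]
    norm_num
  refine ⟨fun m n k => QPlane.primed_apply h0 h1 n m k, fun j m n ψ => ?_⟩
  -- Vectors of finite support are finite sums of basis vectors, and unconditional sums add.
  induction ψ using Finsupp.induction_linear with
  | zero =>
    simp only [map_zero, smul_zero]
    exact hasSum_zero
  | add f g hf hg =>
    simp only [map_add, smul_add]
    exact hf.add hg
  | single k a => exact QPlane.hasSum_single h0 h1 lam j k m n a
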